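/- **Corollary 4.3.** Let \(W\) be a real separable Hilbert space with norm \(\|\cdot\|_W\), let \(\mu\) be a centered non-degenerate Gaussian probability measure on \(W\) (that is, for every continuous linear functional \(\ell\) on \(W\) the push-forward of \(\mu\) by \(\ell\) is a Gaussian law on \(\mathbb{R}\) with mean \(0\), and with non-zero variance whenever \(\ell\neq 0\)), and let \(x,y\in W\). By a \(\mu\)-Brownian motion started at \(x\) we mean a \(W\)-valued process \((B(t))_{t\ge 0}\) with almost surely continuous paths, with \(B(0)=x\) almost surely, and with independent increments such that for \(0\le s\le t\) the increment \(B(t)-B(s)\) has the law of \(\sqrt{t-s}\,Z\), where \(Z\) has law \(\mu\). Then the \(\mu\)-Brownian motions started at \(x\) and at \(y\) can be coupled at time \(\infty\): there are a \(\mu\)-Brownian motion \(B\) started at \(x\) and a \(\mu\)-Brownian motion \(\widetilde B\) started at \(y\), defined on a common probability space, such that \[ \mathbb{P}\Bigl[\,\|\widetilde B(t)-B(t)\|_W\to 0 \text{ as } t\to\infty\Bigr]=1 . \] Moreover, for every \(\mu\)-Brownian motion \(B\) started at \(x\), on any probability space, such a \(\widetilde B\) exists on the same probability space. -/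

import Mathlib

open MeasureTheory ProbabilityTheory Filter Topology
open scoped NNReal

universe u v

/-- A Gaussian probability measure on a (separable) Banach space that is centered and
non-degenerate: the push-forward under each continuous linear functional is a Gaussian
probability measure on `ℝ` (Mathlib's `IsGaussian`), its mean is always `0`, and its
variance is non-zero for every non-zero functional. -/
structure IsCenteredNondegenerateGaussian {W : Type*} [NormedAddCommGroup W] [NormedSpace ℝ W]
    [MeasurableSpace W] [BorelSpace W] (μ : Measure W) : Prop where
  gaussian : IsGaussian μ
  mean_eq_zero : ∀ ℓ : StrongDual ℝ W, ∫ w, ℓ w ∂μ = 0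
  variance_ne_zero : ∀ ℓ : StrongDual ℝ W, ℓ ≠ 0 → variance (fun w ↦ ℓ w) μ ≠ 0

/-- `IsBanachBrownianMotion μ x B P`: under `P`, the process `B` is the `W`-valued Brownian motion
started at the point `x` that corresponds to the centered Gaussian measure `μ`
(so that `μ` is the law of `B 1 - B 0`): the increments are independent, the increment over
`[s, t]` is distributed as `√(t - s) • w` with `w` of law `μ`, and almost every path is
continuous. As the starting point is deterministic, independence of the increments is the
same as independence of each increment from the past of `B`. -/
structure IsBanachBrownianMotion {W : Type*} [NormedAddCommGroup W] [NormedSpace ℝ W]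
    [MeasurableSpace W] [BorelSpace W] {Ω : Type*} [MeasurableSpace Ω]
    (μ : Measure W) (x : W) (B : ℝ≥0 → Ω → W) (P : Measure Ω) : Prop where
  measurable : ∀ t, Measurable (B t)
  start : ∀ᵐ ω ∂P, B 0 ω = x
  indep_increments : HasIndepIncrements B P
  law_increment : ∀ s t : ℝ≥0, s ≤ t →
    HasLaw (fun ω ↦ B t ω - B s ω) (μ.map (fun w ↦ √((t : ℝ) - (s : ℝ)) • w)) P
  continuous_paths : ∀ᵐ ω ∂P, Continuous (fun t ↦ B t ω)

/-- Two processes with values in a normed space, on a common probability space, couple at time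
`∞` almost surely: the norm of their difference tends to `0` as time tends to infinity. -/
def CoupleAtInfinity {W : Type*} [NormedAddCommGroup W] {Ω : Type*} [MeasurableSpace Ω]
    (B B' : ℝ≥0 → Ω → W) (P : Measure Ω) : Prop :=
  ∀ᵐ ω ∂P, Tendsto (fun t : ℝ≥0 ↦ ‖B' t ω - B t ω‖) atTop (𝓝 0)

/-!
Write `Q` for the covariance operator of `μ`. Non-degeneracy says that `⟪u, Q u⟫ > 0` for `u ≠ 0`,
so that `Q` has dense range, and `y - x` is a sum of vectors `h n` in the range of `Q` whose norms
decrease as fast as desired. It therefore suffices to couple Brownian motions whose starting points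
differ by some `h = Q u`, with good control of the distance, and to compose these couplings.

*One reflection.* The reflection `R w = w - (2 / ⟪u, Q u⟫) ⟪u, w⟫ • Q u` preserves `μ`
(`IsCenteredNondegenerateGaussian.map_covarianceReflection`). Reflecting the increments of `B` by
`R` produces a process whose difference to `B` is a real multiple of `h`; that multiple starts at
`1` and is an affine function of `⟪u, B⟫` (`gapPath`). The reflection is switched off when
it reaches `0`, which happens almost surely. That the mirror process is again a Brownian motion is
`IsBanachBrownianMotion.sameFiniteDimLaws_mirrorProcess`. It needs no strong Markov property: along
a dyadic grid it says that the joint law of independent increments does not change when each of them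
is or is not reflected according to the earlier ones (`map_predictable_transform`), and the mesh
then tends to `0`.

*Uniform control.* The reflection principle at all levels and the explicit Gaussian law of the gap
bound the probability that the distance ever exceeds `(1 + M) ‖h‖` by a quantity `mirrorTail M` that
depends only on `M` and tends to `0` as `M → ∞` (`IsBanachBrownianMotion.exists_mirror_coupling`).

*Infinitely many reflections.* As the bound does not depend on `h`, the norms of the `h n` can be
chosen such that, by the Borel–Cantelli lemma, all but finitely many of the successive distances
stay below `2 ^ (-n)` for all times. The reflected processes then converge uniformly, the limit is a
Brownian motion started at `y`, and dominated convergence for series shows that its distance to `B`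
tends to `0`, because each single one does (`IsBanachBrownianMotion.exists_coupleAtInfinity`).

*Existence.* That there is a Brownian motion at all is shown by Lévy's midpoint construction from
independent vectors of law `μ` (`exists_isBanachBrownianMotion`).
-/

set_option linter.unusedSectionVars false

/-! ### Processes with the same finite-dimensional laws -/

/-- The processes `X` and `Y` have the same finite-dimensional laws under `P`. The time points
are indexed by `Fin n` and may be repeated. -/
def SameFiniteDimLaws {W Ω : Type*} [MeasurableSpace W] [MeasurableSpace Ω]
    (X Y : ℝ≥0 → Ω → W) (P : Measure Ω) : Prop :=
  ∀ (n : ℕ) (t : Fin n → ℝ≥0),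
    P.map (fun ω i ↦ X (t i) ω) = P.map (fun ω i ↦ Y (t i) ω)

/-- Equality in law passes to almost sure limits. -/
theorem map_eq_of_tendsto_ae {Ω Ω' E : Type*} [MeasurableSpace Ω] [MeasurableSpace Ω']
    [TopologicalSpace E] [TopologicalSpace.PseudoMetrizableSpace E]
    [MeasurableSpace E] [BorelSpace E] {P : Measure Ω} [IsProbabilityMeasure P]
    {P' : Measure Ω'} [IsProbabilityMeasure P']
    {U : ℕ → Ω → E} {V : ℕ → Ω' → E} {u : Ω → E} {v : Ω' → E}
    (hU : ∀ m, AEMeasurable (U m) P) (hV : ∀ m, AEMeasurable (V m) P')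
    (hu : ∀ᵐ ω ∂P, Tendsto (fun m ↦ U m ω) atTop (𝓝 (u ω)))
    (hv : ∀ᵐ ω ∂P', Tendsto (fun m ↦ V m ω) atTop (𝓝 (v ω)))
    (h : ∀ᶠ m in atTop, P.map (U m) = P'.map (V m)) : P.map u = P'.map v := by
  have mu : AEMeasurable u P := aemeasurable_of_tendsto_metrizable_ae' hU hu
  have mv : AEMeasurable v P' := aemeasurable_of_tendsto_metrizable_ae' hV hv
  have := Measure.isProbabilityMeasure_map mu
  have := Measure.isProbabilityMeasure_map mv
  let := TopologicalSpace.pseudoMetrizableSpacePseudoMetric E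
  refine ext_of_forall_integral_eq_of_IsFiniteMeasure fun f ↦ ?_
  have hf : Continuous f := f.continuous
  rw [integral_map mu hf.measurable.aestronglyMeasurable,
    integral_map mv hf.measurable.aestronglyMeasurable]
  have lu : Tendsto (fun m ↦ ∫ ω, f (U m ω) ∂P) atTop (𝓝 (∫ ω, f (u ω) ∂P)) := by
    refine tendsto_integral_of_dominated_convergence (fun _ ↦ ‖f‖)
      (fun m ↦ (hf.measurable.comp_aemeasurable (hU m)).aestronglyMeasurable)
      (integrable_const _) (fun m ↦ .of_forall fun ω ↦ f.norm_coe_le_norm _) ?_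
    filter_upwards [hu] with ω hω using (hf.tendsto _).comp hω
  have lv : Tendsto (fun m ↦ ∫ ω, f (V m ω) ∂P') atTop (𝓝 (∫ ω, f (v ω) ∂P')) := by
    refine tendsto_integral_of_dominated_convergence (fun _ ↦ ‖f‖)
      (fun m ↦ (hf.measurable.comp_aemeasurable (hV m)).aestronglyMeasurable)
      (integrable_const _) (fun m ↦ .of_forall fun ω ↦ f.norm_coe_le_norm _) ?_
    filter_upwards [hv] with ω hω using (hf.tendsto _).comp hω
  refine tendsto_nhds_unique (lu.congr' ?_) lv
  filter_upwards [h] with m hm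
  rw [← integral_map (hU m) hf.measurable.aestronglyMeasurable, hm,
    integral_map (hV m) hf.measurable.aestronglyMeasurable]

theorem SameFiniteDimLaws.trans {W Ω : Type*} [MeasurableSpace W] [MeasurableSpace Ω]
    {X Y Z : ℝ≥0 → Ω → W} {P : Measure Ω} (h : SameFiniteDimLaws X Y P)
    (h' : SameFiniteDimLaws Y Z P) : SameFiniteDimLaws X Z P :=
  fun n t ↦ (h n t).trans (h' n t)

/-- Images of finite families of values under a measurable map have the same law. -/
theorem SameFiniteDimLaws.map_comp {W Ω E : Type*} [MeasurableSpace W] [MeasurableSpace Ω]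
    [MeasurableSpace E] {X Y : ℝ≥0 → Ω → W} {P : Measure Ω} (h : SameFiniteDimLaws X Y P)
    (hX : ∀ t, Measurable (X t)) (hY : ∀ t, Measurable (Y t)) {n : ℕ} (t : Fin n → ℝ≥0)
    {g : (Fin n → W) → E} (hg : Measurable g) :
    P.map (fun ω ↦ g fun i ↦ X (t i) ω) = P.map (fun ω ↦ g fun i ↦ Y (t i) ω) := by
  have := congrArg (Measure.map g) (h n t)
  rwa [Measure.map_map hg (by fun_prop), Measure.map_map hg (by fun_prop)] at this

/-- A process with continuous paths whose displacement has the finite-dimensional laws of the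
displacement of a Brownian motion is a Brownian motion. -/
theorem IsBanachBrownianMotion.of_sameFiniteDimLaws {W Ω : Type*} [NormedAddCommGroup W]
    [NormedSpace ℝ W] [SecondCountableTopology W] [MeasurableSpace W] [BorelSpace W]
    [MeasurableSpace Ω] {μ : Measure W} {P : Measure Ω} [IsProbabilityMeasure P]
    {x y : W} {B B' : ℝ≥0 → Ω → W} (hB : IsBanachBrownianMotion μ x B P)
    (hm : ∀ t, Measurable (B' t)) (hc : ∀ᵐ ω ∂P, Continuous fun t ↦ B' t ω)
    (h : SameFiniteDimLaws (fun t ω ↦ B' t ω - y) (fun t ω ↦ B t ω - x) P) :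
    IsBanachBrownianMotion μ y B' P := by
  have mB := hB.measurable
  have key {n : ℕ} {E : Type _} [MeasurableSpace E] (t : Fin n → ℝ≥0) {g : (Fin n → W) → E}
      (hg : Measurable g) := h.map_comp (fun t ↦ (hm t).sub_const y)
        (fun t ↦ (mB t).sub_const x) t hg
  have incr (s t : ℝ≥0) : P.map (fun ω ↦ B' t ω - B' s ω) = P.map (fun ω ↦ B t ω - B s ω) := by
    simpa using key ![s, t] (g := fun w ↦ w 1 - w 0) (by fun_prop)
  refine ⟨hm, ?_, fun n t ht ↦ ?_, fun s t hst ↦ ⟨((hm t).sub (hm s)).aemeasurable, ?_⟩, hc⟩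
  · have h0 : P.map (B' 0) {w | w ≠ y} = P.map (fun ω ↦ B 0 ω - x + y) {w | w ≠ y} := by
      have := key ![0] (g := fun w ↦ w 0 + y) (by fun_prop)
      simp only [Matrix.cons_val_zero, sub_add_cancel] at this
      rw [← this]
    have ms : MeasurableSet {w : W | w ≠ y} := (measurableSet_singleton y).compl
    rw [Measure.map_apply (hm 0) ms, Measure.map_apply (by fun_prop) ms] at h0
    refine (h0.trans ?_ : P {ω | ¬ B' 0 ω = y} = 0)
    refine measure_mono_null (fun ω hω ↦ ?_) (ae_iff.1 hB.start)
    intro hx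
    simp [hx] at hω
  · have hBi := hB.indep_increments n t ht
    rw [iIndepFun_iff_map_fun_eq_pi_map (fun i ↦ by fun_prop)] at hBi ⊢
    simp_rw [incr]
    rw [← hBi]
    simpa using key t (g := fun w (i : Fin n) ↦ w i.succ - w i.castSucc) (by fun_prop)
  · rw [incr, (hB.law_increment s t hst).map_eq]

/-! ### Stopping a path at its first non-positive dyadic value -/

/-- The first index `j` with `p j`, or `k` if there is none before `k`. -/
noncomputable def stopIndex (p : ℕ → Prop) (k : ℕ) : ℕ := sInf {j | p j ∨ k ≤ j}

theorem stopIndex_mem (p : ℕ → Prop) (k : ℕ) : p (stopIndex p k) ∨ k ≤ stopIndex p k :=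
  Nat.sInf_mem (s := {j | p j ∨ k ≤ j}) ⟨k, Or.inr le_rfl⟩

theorem stopIndex_le (p : ℕ → Prop) (k : ℕ) : stopIndex p k ≤ k := Nat.sInf_le (Or.inr le_rfl)

theorem stopIndex_le_of_mem {p : ℕ → Prop} {j : ℕ} (k : ℕ) (hj : p j) : stopIndex p k ≤ j :=
  Nat.sInf_le (Or.inl hj)

theorem stopIndex_of_forall_not {p : ℕ → Prop} {k : ℕ} (h : ∀ j < k, ¬ p j) :
    stopIndex p k = k := by
  refine (stopIndex_le p k).antisymm (not_lt.1 fun hlt ↦ ?_)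
  rcases stopIndex_mem p k with h1 | h1
  · exact h _ hlt h1
  · omega

theorem stopIndex_zero (p : ℕ → Prop) : stopIndex p 0 = 0 := Nat.le_zero.1 (stopIndex_le p 0)

theorem stopIndex_succ_of_exists {p : ℕ → Prop} {k : ℕ} (h : ∃ j ≤ k, p j) :
    stopIndex p (k + 1) = stopIndex p k := by
  obtain ⟨j, hjk, hj⟩ := h
  have key (l : ℕ) (hl : k ≤ l) : p (stopIndex p l) := by
    rcases stopIndex_mem p l with h | h
    · exact h
    · have h1 := stopIndex_le_of_mem l hj
      have : stopIndex p l = j := by omega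
      rwa [this]
  exact le_antisymm (stopIndex_le_of_mem _ (key k le_rfl))
    (stopIndex_le_of_mem _ (key _ (by omega)))

/-- The largest multiple of `2 ^ (-m)` which is at most `t`. -/
noncomputable def dyadicFloor (m : ℕ) (t : ℝ≥0) : ℝ≥0 := ⌊2 ^ m * t⌋₊ / 2 ^ m

theorem dyadicFloor_le (m : ℕ) (t : ℝ≥0) : dyadicFloor m t ≤ t := by
  rw [dyadicFloor, div_le_iff₀ (by positivity), mul_comm t]
  exact Nat.floor_le (by positivity)

theorem tendsto_dyadicFloor (t : ℝ≥0) : Tendsto (fun m ↦ dyadicFloor m t) atTop (𝓝 t) := by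
  have h := (tendsto_nat_floor_mul_div_atTop (R := ℝ) t.2).comp
    (tendsto_pow_atTop_atTop_of_one_lt (one_lt_two (α := ℝ)))
  rw [← NNReal.tendsto_coe]
  refine h.congr fun m ↦ ?_
  have : ⌊(t : ℝ) * 2 ^ m⌋₊ = ⌊2 ^ m * t⌋₊ := by
    rw [mul_comm, Nat.floor_eq_iff (by positivity)]
    exact ⟨by exact_mod_cast Nat.floor_le (a := 2 ^ m * t) zero_le,
      by exact_mod_cast Nat.lt_floor_add_one (2 ^ m * t)⟩
  simp [dyadicFloor, this]

theorem dyadicFloor_dyadic {m n : ℕ} (hmn : m ≤ n) (j : ℕ) :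
    ∃ i : ℕ, (j / 2 ^ m : ℝ≥0) = i / 2 ^ n := by
  refine ⟨j * 2 ^ (n - m), ?_⟩
  have : (2 : ℝ≥0) ^ n = 2 ^ (n - m) * 2 ^ m := by rw [← pow_add]; congr 1; omega
  rw [this]
  push_cast
  field_simp

/-- The dyadic rationals strictly below `t > 0` accumulate at `t`. -/
theorem nonneg_of_forall_dyadic_lt {f : ℝ≥0 → ℝ} (hf : Continuous f) {t : ℝ≥0} (ht : 0 < t)
    (h : ∀ m j : ℕ, (j / 2 ^ m : ℝ≥0) < t → 0 ≤ f (j / 2 ^ m)) : 0 ≤ f t := by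
  have hd : Dense {s : ℝ≥0 | ∃ m j : ℕ, s = j / 2 ^ m} := fun s ↦
    mem_closure_of_tendsto (tendsto_dyadicFloor s) (.of_forall fun m ↦ ⟨m, _, rfl⟩)
  have h1 : t ∈ closure (Set.Iio t) := by
    rw [closure_Iio' (a := t) ⟨0, ht⟩]
    exact Set.mem_Iic.2 le_rfl
  have h2 : Set.Iio t ∩ {s : ℝ≥0 | ∃ m j : ℕ, s = j / 2 ^ m} ⊆ f ⁻¹' Set.Ici 0 := by
    rintro s ⟨hs, m, j, rfl⟩
    exact h m j hs
  have h3 := (hd.open_subset_closure_inter isOpen_Iio).trans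
    (closure_minimal h2 (isClosed_Ici.preimage hf))
  exact closure_minimal h3 (isClosed_Ici.preimage hf) h1

/-- The path `f` takes a non-positive value at some dyadic time up to `t`. -/
def HitsBy (f : ℝ≥0 → ℝ) (t : ℝ≥0) : Prop :=
  ∃ m j : ℕ, (j / 2 ^ m : ℝ≥0) ≤ t ∧ f (j / 2 ^ m) ≤ 0

open Classical in
/-- The path `f` stopped at its first non-positive dyadic value. For a continuous path that
starts above `0` the value at the stopping time is `0`, which is why `0` can be prescribed
afterwards. -/
noncomputable def stoppedPath (f : ℝ≥0 → ℝ) (t : ℝ≥0) : ℝ := if HitsBy f t then 0 else f t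

theorem HitsBy.mono {f : ℝ≥0 → ℝ} {s t : ℝ≥0} (h : HitsBy f s) (hst : s ≤ t) : HitsBy f t := by
  obtain ⟨m, j, h1, h2⟩ := h
  exact ⟨m, j, h1.trans hst, h2⟩

theorem nonneg_of_not_hitsBy {f : ℝ≥0 → ℝ} (hf : Continuous f) {t : ℝ≥0}
    (h : ¬ HitsBy f t) : 0 ≤ f t := by
  simp only [HitsBy, not_exists, not_and, not_le] at h
  rcases eq_zero_or_pos t with rfl | ht
  · simpa using (h 0 0 (by simp)).le
  · exact nonneg_of_forall_dyadic_lt hf ht fun m j hj ↦ (h m j hj.le).le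

/-- The set of dyadic times at which the path `f` is non-positive. -/
def hitSet (f : ℝ≥0 → ℝ) : Set ℝ≥0 := {s | (∃ m j : ℕ, s = j / 2 ^ m) ∧ f s ≤ 0}

theorem hitsBy_iff {f : ℝ≥0 → ℝ} {t : ℝ≥0} : HitsBy f t ↔ ∃ s ∈ hitSet f, s ≤ t := by
  constructor
  · rintro ⟨m, j, h1, h2⟩
    exact ⟨_, ⟨⟨m, j, rfl⟩, h2⟩, h1⟩
  · rintro ⟨_, ⟨⟨m, j, rfl⟩, h2⟩, h1⟩
    exact ⟨m, j, h1, h2⟩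

theorem apply_sInf_hitSet {f : ℝ≥0 → ℝ} (hf : Continuous f) (h0 : 0 < f 0)
    (hne : (hitSet f).Nonempty) : f (sInf (hitSet f)) = 0 := by
  have hle : f (sInf (hitSet f)) ≤ 0 :=
    closure_minimal (fun s hs ↦ hs.2) (isClosed_Iic.preimage hf)
      (csInf_mem_closure hne (OrderBot.bddBelow _))
  refine le_antisymm hle ?_
  have hpos : 0 < sInf (hitSet f) := by
    refine pos_iff_ne_zero.2 fun h ↦ ?_
    rw [h] at hle
    exact absurd h0 hle.not_gt
  refine nonneg_of_forall_dyadic_lt hf hpos fun m j hj ↦ ?_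
  by_contra! hlt
  exact absurd (csInf_le (OrderBot.bddBelow _) (show _ ∈ hitSet f from ⟨⟨m, j, rfl⟩, hlt.le⟩))
    hj.not_ge

theorem stoppedPath_eq_min {f : ℝ≥0 → ℝ} (hf : Continuous f) (h0 : 0 < f 0)
    (hne : (hitSet f).Nonempty) (t : ℝ≥0) :
    stoppedPath f t = f (min t (sInf (hitSet f))) := by
  have hz := apply_sInf_hitSet hf h0 hne
  rw [stoppedPath]
  split_ifs with h
  · obtain ⟨s, hs, hst⟩ := hitsBy_iff.1 h
    rw [min_eq_right ((csInf_le (OrderBot.bddBelow _) hs).trans hst), hz]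
  · rcases le_total t (sInf (hitSet f)) with h1 | h1
    · rw [min_eq_left h1]
    · rcases h1.eq_or_lt with h2 | h2
      · rw [← h2, min_self]
      · obtain ⟨s, hs, hst⟩ := exists_lt_of_csInf_lt hne h2
        exact absurd (hitsBy_iff.2 ⟨s, hs, hst.le⟩) h

theorem continuous_stoppedPath {f : ℝ≥0 → ℝ} (hf : Continuous f) (h0 : 0 < f 0) :
    Continuous (stoppedPath f) := by
  rcases (hitSet f).eq_empty_or_nonempty with he | hne
  · have : stoppedPath f = f := by
      funext t
      rw [stoppedPath, if_neg]
      rw [hitsBy_iff, he]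
      simp
    rwa [this]
  · have : stoppedPath f = fun t ↦ f (min t (sInf (hitSet f))) :=
      funext (stoppedPath_eq_min hf h0 hne)
    rw [this]
    fun_prop

theorem tendsto_stoppedPath {f : ℝ≥0 → ℝ} {T : ℝ≥0} (h : HitsBy f T) :
    Tendsto (stoppedPath f) atTop (𝓝 0) := by
  refine tendsto_const_nhds.congr' ?_
  filter_upwards [eventually_ge_atTop T] with t ht
  rw [stoppedPath, if_pos (h.mono ht)]

/-- Stopping along the grid of mesh `2 ^ (-m)` converges to stopping along all dyadic times. -/
theorem tendsto_gridStopped {f : ℝ≥0 → ℝ} (hf : Continuous f) (h0 : 0 < f 0) (t : ℝ≥0) :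
    Tendsto (fun m : ℕ ↦ f (stopIndex (fun j ↦ f (j / 2 ^ m) ≤ 0) ⌊2 ^ m * t⌋₊ / 2 ^ m)) atTop
      (𝓝 (stoppedPath f t)) := by
  by_cases h : HitsBy f t
  · have hne : (hitSet f).Nonempty := by
      obtain ⟨s, hs, -⟩ := hitsBy_iff.1 h
      exact ⟨s, hs⟩
    have hz : stoppedPath f t = f (sInf (hitSet f)) := by
      rw [stoppedPath, if_pos h, apply_sInf_hitSet hf h0 hne]
    rw [hz]
    refine (hf.tendsto _).comp (tendsto_order.2 ⟨fun a ha ↦ ?_, fun a ha ↦ ?_⟩)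
    all_goals
      obtain ⟨s, hs, hsa, hst⟩ : ∃ s ∈ hitSet f, (a ≤ sInf (hitSet f) ∨ s < a) ∧ s ≤ t := by
        obtain ⟨s, hs, hst⟩ := hitsBy_iff.1 h
        rcases le_or_gt a (sInf (hitSet f)) with h1 | h1
        · exact ⟨s, hs, Or.inl h1, hst⟩
        · obtain ⟨r, hr, hra⟩ := exists_lt_of_csInf_lt hne h1
          exact ⟨min r s, by rcases min_choice r s with h | h <;> rwa [h],
            Or.inr ((min_le_left _ _).trans_lt hra), (min_le_right _ _).trans hst⟩
      obtain ⟨⟨n, j, rfl⟩, hfs⟩ := hs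
      filter_upwards [eventually_ge_atTop n] with m hm
      obtain ⟨i, hi⟩ := dyadicFloor_dyadic hm j
      rw [hi] at hfs hst hsa
      have hle := stopIndex_le_of_mem (p := fun j : ℕ ↦ f (j / 2 ^ m) ≤ 0) ⌊2 ^ m * t⌋₊ hfs
    · have hit : i ≤ ⌊2 ^ m * t⌋₊ := by
        refine Nat.le_floor ?_
        rwa [div_le_iff₀ (by positivity), mul_comm t] at hst
      refine ha.trans_le (csInf_le (OrderBot.bddBelow _) ⟨⟨m, _, rfl⟩, ?_⟩)
      rcases stopIndex_mem (fun j : ℕ ↦ f (j / 2 ^ m) ≤ 0) ⌊2 ^ m * t⌋₊ with h | h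
      · exact h
      · rwa [show stopIndex (fun j : ℕ ↦ f (j / 2 ^ m) ≤ 0) ⌊2 ^ m * t⌋₊ = i by omega]
    · refine lt_of_le_of_lt ?_ (hsa.resolve_left ha.not_ge)
      gcongr
  · rw [stoppedPath, if_neg h]
    refine ((hf.tendsto t).comp (tendsto_dyadicFloor t)).congr fun m ↦ ?_
    rw [stopIndex_of_forall_not]
    · rfl
    · intro j hj hfj
      refine h ⟨m, j, le_trans ?_ (dyadicFloor_le m t), hfj⟩
      rw [dyadicFloor]
      gcongr

/-! ### Predictable transformations of independent variables -/

open Classical in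
/-- Let `X k` be independent variables whose laws are preserved by `R`. If for each `k` it is
decided from `X 0, …, X (k - 1)` whether `R` is applied to `X k`, the joint law is unchanged. -/
theorem map_predictable_transform {Ω W : Type*} [mΩ : MeasurableSpace Ω] [mW : MeasurableSpace W]
    {P : Measure Ω} [IsProbabilityMeasure P] {X : ℕ → Ω → W} (hX : ∀ k, Measurable (X k))
    (hi : iIndepFun X P) {R : W → W} (hR : Measurable R)
    (hinv : ∀ k, (P.map (X k)).map R = P.map (X k)) {C : ℕ → Set Ω}
    (hC : ∀ k, MeasurableSet[⨆ j ∈ Set.Iio k, mW.comap (X j)] (C k)) (N : ℕ) :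
    P.map (fun ω (j : Fin N) ↦ if ω ∈ C j then X j ω else R (X j ω)) =
      P.map (fun ω (j : Fin N) ↦ X j ω) := by
  set Y : ℕ → Ω → W := fun j ω ↦ if ω ∈ C j then X j ω else R (X j ω) with hY
  have le (k : ℕ) : (⨆ j ∈ Set.Iio k, mW.comap (X j)) ≤ mΩ :=
    iSup₂_le fun j _ ↦ (hX j).comap_le
  have mono {k l : ℕ} (h : k ≤ l) :
      (⨆ j ∈ Set.Iio k, mW.comap (X j)) ≤ ⨆ j ∈ Set.Iio l, mW.comap (X j) :=
    biSup_mono fun j hj ↦ lt_of_lt_of_le hj h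
  have mXlt {j k : ℕ} (h : j < k) : Measurable[⨆ j ∈ Set.Iio k, mW.comap (X j)] (X j) :=
    Measurable.mono (comap_measurable (X j))
      (le_iSup₂_of_le (f := fun j (_ : j ∈ Set.Iio k) ↦ mW.comap (X j)) j h le_rfl) le_rfl
  have mY {j k : ℕ} (h : j < k) : Measurable[⨆ j ∈ Set.Iio k, mW.comap (X j)] (Y j) :=
    Measurable.ite (mono h.le _ (hC j)) (mXlt h) (hR.comp (mXlt h))
  have ind (k : ℕ) : Indep (⨆ j ∈ Set.Iio k, mW.comap (X j)) (mW.comap (X k)) P := by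
    have := indep_iSup_of_disjoint (S := Set.Iio k) (T := {k}) (fun j ↦ (hX j).comap_le) hi
      (by simp)
    simpa using this
  have key (E : ℕ → Set W) (hE : ∀ j, MeasurableSet (E j)) (n : ℕ) :
      P {ω | ∀ j < n, Y j ω ∈ E j} = ∏ j ∈ Finset.range n, P (X j ⁻¹' E j) := by
    induction n with
    | zero => simp
    | succ n ih =>
      -- Whether `ω ∈ C n`, and what has happened before, is independent of `X n`; on either part
      -- the law of the `n`-th variable is that of `X n`.
      have mA : MeasurableSet[⨆ j ∈ Set.Iio n, mW.comap (X j)] {ω | ∀ j < n, Y j ω ∈ E j} := by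
        simp only [Set.ofPred_forall]
        refine MeasurableSet.iInter fun j ↦ MeasurableSet.iInter fun hj ↦ mY hj (hE j)
      have hsplit : {ω | ∀ j < n + 1, Y j ω ∈ E j} =
          ({ω | ∀ j < n, Y j ω ∈ E j} ∩ C n) ∩ X n ⁻¹' E n ∪
          ({ω | ∀ j < n, Y j ω ∈ E j} ∩ (C n)ᶜ) ∩ X n ⁻¹' (R ⁻¹' E n) := by
        ext ω
        simp only [Set.mem_ofPred_eq, Set.mem_union, Set.mem_inter_iff, Set.mem_preimage,
          Set.mem_compl_iff, Nat.forall_lt_succ_right]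
        by_cases h : ω ∈ C n <;> simp [hY, h]
      rw [hsplit, measure_union, (Indep_iff _ _ _).1 (ind n) _ _ (mA.inter (hC n)) ⟨E n, hE n, rfl⟩,
        (Indep_iff _ _ _).1 (ind n) _ _ (mA.inter (hC n).compl) ⟨R ⁻¹' E n, hR (hE n), rfl⟩,
        Finset.prod_range_succ, ← ih]
      · have : P (X n ⁻¹' (R ⁻¹' E n)) = P (X n ⁻¹' E n) := by
          have h := congrArg (fun m ↦ m (E n)) (hinv n)
          simpa only [Measure.map_apply hR (hE n), Measure.map_apply (hX n) (hR (hE n)),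
            Measure.map_apply (hX n) (hE n)] using h
        rw [this, ← add_mul, ← Set.sdiff_eq,
          measure_inter_add_sdiff₀ _ ((le n _ (hC n)).nullMeasurableSet)]
      · refine Set.disjoint_left.2 fun ω h1 h2 ↦ h2.1.2 h1.1.2
      · exact ((le n _ (mA.inter (hC n).compl))).inter (hX n (hR (hE n)))
  have mY' (j : ℕ) : Measurable (Y j) := (mY j.lt_succ_self).mono (le _) le_rfl
  have hmap (j : Fin N) := Measure.isProbabilityMeasure_map (μ := P) (hX j).aemeasurable
  have hXi : iIndepFun (fun j : Fin N ↦ X j) P := hi.precomp Fin.val_injective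
  rw [(iIndepFun_iff_map_fun_eq_pi_map fun j : Fin N ↦ (hX j).aemeasurable).1 hXi]
  refine (Measure.pi_eq fun s hs ↦ ?_).symm
  rw [Measure.map_apply (measurable_pi_lambda _ fun j : Fin N ↦ mY' j) (.univ_pi hs)]
  let E : ℕ → Set W := fun j ↦ if h : j < N then s ⟨j, h⟩ else Set.univ
  have hE (j : ℕ) : MeasurableSet (E j) := by
    simp only [E]
    split_ifs with h
    exacts [hs _, .univ]
  have h1 : (fun ω (j : Fin N) ↦ Y j ω) ⁻¹' Set.univ.pi s = {ω | ∀ j < N, Y j ω ∈ E j} := by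
    ext ω
    simp only [Set.mem_preimage, Set.mem_pi, Set.mem_univ, true_imp_iff, Set.mem_ofPred_eq]
    constructor
    · intro h j hj
      simpa [E, hj] using h ⟨j, hj⟩
    · intro h j
      simpa [E] using h j j.2
  rw [h1, key E hE N, Finset.prod_range]
  refine Finset.prod_congr rfl fun j _ ↦ ?_
  rw [Measure.map_apply (hX j) (hs j)]
  simp [E]

/-! ### Reflections that preserve a Gaussian measure -/

section Reflection

variable {W : Type*} [NormedAddCommGroup W] [InnerProductSpace ℝ W] [CompleteSpace W]
  [SecondCountableTopology W] [MeasurableSpace W] [BorelSpace W] {μ : Measure W}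

open InnerProductSpace

theorem IsCenteredNondegenerateGaussian.integral_id_eq_zero
    (hμ : IsCenteredNondegenerateGaussian μ) : ∫ w, w ∂μ = 0 := by
  have := hμ.gaussian
  refine ext_inner_left ℝ fun v ↦ ?_
  have h := hμ.mean_eq_zero (toDual ℝ W v)
  rw [IsGaussian.integral_dual] at h
  simpa using h

theorem IsCenteredNondegenerateGaussian.covariance_inner
    (hμ : IsCenteredNondegenerateGaussian μ) (u v : W) :
    cov[fun w ↦ inner ℝ u w, fun w ↦ inner ℝ v w; μ] = inner ℝ (covarianceOperator μ u) v := by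
  have := hμ.gaussian
  have hu := hμ.mean_eq_zero (toDual ℝ W u)
  have hv := hμ.mean_eq_zero (toDual ℝ W v)
  simp only [toDual_apply_apply] at hu hv
  rw [covarianceOperator_inner IsGaussian.memLp_two_id, covariance, hu, hv]
  simp

theorem IsCenteredNondegenerateGaussian.covarianceBilin_eq
    (hμ : IsCenteredNondegenerateGaussian μ) (u v : W) :
    covarianceBilin μ u v = inner ℝ (covarianceOperator μ u) v := by
  have := hμ.gaussian
  rw [covarianceBilin_apply_eq_cov IsGaussian.memLp_two_id, hμ.covariance_inner]

theorem IsCenteredNondegenerateGaussian.variance_inner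
    (hμ : IsCenteredNondegenerateGaussian μ) (u : W) :
    Var[fun w ↦ inner ℝ u w; μ] = inner ℝ u (covarianceOperator μ u) := by
  rw [← covariance_self (by fun_prop), hμ.covariance_inner, real_inner_comm]

theorem IsCenteredNondegenerateGaussian.inner_covarianceOperator_pos
    (hμ : IsCenteredNondegenerateGaussian μ) {u : W} (hu : u ≠ 0) :
    0 < inner ℝ u (covarianceOperator μ u) := by
  rw [← hμ.variance_inner]
  refine lt_of_le_of_ne (variance_nonneg _ _) (Ne.symm ?_)
  simpa using hμ.variance_ne_zero (toDual ℝ W u) (by simpa using hu)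

/-- Non-degeneracy means that the covariance operator, which is self-adjoint and injective, has
dense range. -/
theorem IsCenteredNondegenerateGaussian.range_covarianceOperator_dense
    (hμ : IsCenteredNondegenerateGaussian μ) :
    (covarianceOperator μ).range.topologicalClosure = ⊤ := by
  rw [Submodule.topologicalClosure_eq_top_iff, Submodule.eq_bot_iff]
  intro u hu
  by_contra hne
  have h := (Submodule.mem_orthogonal' _ _).1 hu (covarianceOperator μ u) ⟨u, rfl⟩
  exact (hμ.inner_covarianceOperator_pos hne).ne' h

/-- The reflection in the hyperplane orthogonal to `u`, with respect to the covariance form of `μ`: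
it fixes the kernel of `⟪u, ·⟫` and sends `Q u` to `-Q u`, where `Q` is the covariance operator
of `μ`. -/
noncomputable def covarianceReflection (μ : Measure W) (u : W) : W →L[ℝ] W :=
  .id ℝ W - (2 / inner ℝ u (covarianceOperator μ u)) •
    (innerSL ℝ u).smulRight (covarianceOperator μ u)

theorem covarianceReflection_apply (μ : Measure W) (u w : W) :
    covarianceReflection μ u w =
      w - (2 / inner ℝ u (covarianceOperator μ u) * inner ℝ u w) • covarianceOperator μ u := by
  simp [covarianceReflection, smul_smul]

theorem IsCenteredNondegenerateGaussian.map_covarianceReflection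
    (hμ : IsCenteredNondegenerateGaussian μ) {u : W} (hu : u ≠ 0) :
    μ.map (covarianceReflection μ u) = μ := by
  have := hμ.gaussian
  have hi : Integrable (fun w : W ↦ w) μ := IsGaussian.integrable_id
  refine IsGaussian.ext ?_ ?_
  · rw [integral_map (by fun_prop) (by fun_prop)]
    simp only [id]
    rw [ContinuousLinearMap.integral_comp_comm _ hi, hμ.integral_id_eq_zero, map_zero]
  · have hadj (v : W) : (covarianceReflection μ u).adjoint v = v -
        (2 / inner ℝ u (covarianceOperator μ u) * inner ℝ (covarianceOperator μ u) v) • u := by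
      refine ext_inner_right ℝ fun w ↦ ?_
      rw [ContinuousLinearMap.adjoint_inner_left, covarianceReflection_apply, inner_sub_right,
        inner_sub_left, inner_smul_left, inner_smul_right, real_inner_comm v]
      simp
      ring
    have hpos := hμ.inner_covarianceOperator_pos hu
    have hs (v : W) : inner ℝ (covarianceOperator μ v) u = inner ℝ (covarianceOperator μ u) v := by
      rw [← hμ.covarianceBilin_eq, ← hμ.covarianceBilin_eq, covarianceBilin_comm]
    ext v w
    rw [covarianceBilin_map IsGaussian.memLp_two_id, hadj, hadj, hμ.covarianceBilin_eq,
      hμ.covarianceBilin_eq]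
    simp only [map_sub, map_smul, inner_sub_left, inner_sub_right,
      inner_smul_left, inner_smul_right, hs, real_inner_comm u (covarianceOperator μ u)]
    simp
    field_simp
    ring

end Reflection

/-! ### Reflecting a Brownian motion until a hitting time -/

section Step

variable {W : Type*} [NormedAddCommGroup W] [InnerProductSpace ℝ W] [CompleteSpace W]
  [SecondCountableTopology W] [MeasurableSpace W] [BorelSpace W] {μ : Measure W}
  {Ω : Type*} [MeasurableSpace Ω] {P : Measure Ω} {x : W} {B : ℝ≥0 → Ω → W}

/-- Along the path of `B`, the coefficient of `a • Q u` in the difference between the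
reflection of `B` that starts at `x + a • Q u` and `B` itself, divided by `a`; here `Q` is the
covariance operator. It starts at `1`. -/
noncomputable def gapPath (μ : Measure W) (x u : W) (a : ℝ) (B : ℝ≥0 → Ω → W) (ω : Ω)
    (t : ℝ≥0) : ℝ :=
  1 - 2 / inner ℝ u (covarianceOperator μ u) / a * inner ℝ u (B t ω - x)

/-- The reflection of `B` that starts at `x + a • Q u`, until it meets `B`; from then on it is
equal to `B`. -/
noncomputable def mirrorProcess (μ : Measure W) (x u : W) (a : ℝ) (B : ℝ≥0 → Ω → W)
    (t : ℝ≥0) (ω : Ω) : W :=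
  B t ω + (a * stoppedPath (gapPath μ x u a B ω) t) • covarianceOperator μ u

theorem IsBanachBrownianMotion.gapPath_zero (hB : IsBanachBrownianMotion μ x B P) (u : W) (a : ℝ) :
    ∀ᵐ ω ∂P, gapPath μ x u a B ω 0 = 1 := by
  filter_upwards [hB.start] with ω hω
  simp [gapPath, hω]

theorem continuous_gapPath {u : W} {a : ℝ} {ω : Ω} (h : Continuous fun t ↦ B t ω) :
    Continuous (gapPath μ x u a B ω) := by
  unfold gapPath
  fun_prop

theorem measurable_gapPath (hB : ∀ t, Measurable (B t)) (u : W) (a : ℝ) (t : ℝ≥0) :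
    Measurable fun ω ↦ gapPath μ x u a B ω t := by
  unfold gapPath
  have := hB t
  fun_prop

theorem measurableSet_hitsBy {f : Ω → ℝ≥0 → ℝ} (hf : ∀ t, Measurable fun ω ↦ f ω t) (t : ℝ≥0) :
    MeasurableSet {ω | HitsBy (f ω) t} := by
  simp only [HitsBy, Set.ofPred_exists]
  refine .iUnion fun m ↦ .iUnion fun j ↦ ?_
  by_cases h : (j / 2 ^ m : ℝ≥0) ≤ t
  · simpa [h] using measurableSet_le (hf _) measurable_const
  · simp [h]

theorem measurable_stoppedPath {f : Ω → ℝ≥0 → ℝ} (hf : ∀ t, Measurable fun ω ↦ f ω t) (t : ℝ≥0) :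
    Measurable fun ω ↦ stoppedPath (f ω) t :=
  Measurable.ite (measurableSet_hitsBy hf t) measurable_const (hf t)

theorem measurable_mirrorProcess (hB : ∀ t, Measurable (B t)) (u : W) (a : ℝ) (t : ℝ≥0) :
    Measurable (mirrorProcess μ x u a B t) := by
  have h1 := hB t
  have h2 := measurable_stoppedPath (measurable_gapPath (μ := μ) (x := x) hB u a) t
  unfold mirrorProcess
  fun_prop

/-- The law of an increment is preserved by the reflection. -/
theorem IsBanachBrownianMotion.map_increment_covarianceReflection
    (hμ : IsCenteredNondegenerateGaussian μ) (hB : IsBanachBrownianMotion μ x B P) {u : W}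
    (hu : u ≠ 0) {s t : ℝ≥0} (hst : s ≤ t) :
    (P.map fun ω ↦ B t ω - B s ω).map (covarianceReflection μ u) =
      P.map fun ω ↦ B t ω - B s ω := by
  rw [(hB.law_increment s t hst).map_eq, Measure.map_map (by fun_prop) (by fun_prop)]
  conv_rhs => rw [← hμ.map_covarianceReflection hu]
  rw [Measure.map_map (by fun_prop) (by fun_prop)]
  congr 1
  funext w
  simp

/-- Before the stopping index each grid increment of `B` is reflected, afterwards it is kept. -/
theorem sum_gridIncrements_eq {w : ℕ → W} {u : W} {a : ℝ} (ha : a ≠ 0)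
    {p : ℕ → Prop} [DecidablePred fun k ↦ ∃ j ≤ k, p j] (k : ℕ) :
    ∑ j ∈ Finset.range k, (if ∃ i ≤ j, p i then w (j + 1) - w j
        else covarianceReflection μ u (w (j + 1) - w j)) =
      w k - w 0 - a • covarianceOperator μ u + (a * (1 -
        2 / inner ℝ u (covarianceOperator μ u) / a * inner ℝ u (w (stopIndex p k) - w 0))) •
          covarianceOperator μ u := by
  induction k with
  | zero => simp [stopIndex_zero]
  | succ k ih =>
    rw [Finset.sum_range_succ, ih]
    split_ifs with h
    · rw [stopIndex_succ_of_exists h]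
      abel
    · push Not at h
      rw [stopIndex_of_forall_not fun j hj ↦ h j hj.le,
        stopIndex_of_forall_not fun j hj ↦ h j (Nat.le_of_lt_succ hj), covarianceReflection_apply]
      have e (r s : ℝ) : a * (1 - r / a * s) = a - r * s := by field_simp
      simp only [e, inner_sub_right]
      module

open Classical in
/-- The mirror process has the finite-dimensional laws of `B`, up to
the shift of the starting point: this holds for the reflection that is stopped along the grid
of mesh `2 ^ (-m)`, where only finitely many independent increments matter, and passes to the
limit `m → ∞`. -/
theorem IsBanachBrownianMotion.sameFiniteDimLaws_mirrorProcess [IsProbabilityMeasure P]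
    (hμ : IsCenteredNondegenerateGaussian μ) (hB : IsBanachBrownianMotion μ x B P) {u : W}
    (hu : u ≠ 0) {a : ℝ} (ha : a ≠ 0) :
    SameFiniteDimLaws
      (fun t ω ↦ mirrorProcess μ x u a B t ω - (x + a • covarianceOperator μ u))
      (fun t ω ↦ B t ω - x) P := by
  intro n t
  have mB := hB.measurable
  let X (m j : ℕ) (ω : Ω) : W := B ((j + 1 : ℕ) / 2 ^ m) ω - B (j / 2 ^ m) ω
  obtain ⟨C, C_def⟩ : ∃ C : ℕ → ℕ → Set Ω, ∀ m k, C m k = {ω | ∃ j ≤ k,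
    1 - 2 / inner ℝ u (covarianceOperator μ u) / a *
      inner ℝ u (∑ i ∈ Finset.range j, X m i ω) ≤ 0} := ⟨_, fun _ _ ↦ rfl⟩
  have mX (m j : ℕ) : Measurable (X m j) := by fun_prop
  have mC (m k : ℕ) : MeasurableSet[⨆ j ∈ Set.Iio k, MeasurableSpace.comap (X m j) inferInstance]
      (C m k) := by
    have mXlt {j : ℕ} (h : j < k) :
        Measurable[⨆ j ∈ Set.Iio k, MeasurableSpace.comap (X m j) inferInstance] (X m j) :=
      Measurable.mono (comap_measurable (X m j)) (le_iSup₂_of_le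
        (f := fun j (_ : j ∈ Set.Iio k) ↦ MeasurableSpace.comap (X m j) inferInstance)
          j h le_rfl) le_rfl
    generalize (⨆ j ∈ Set.Iio k, MeasurableSpace.comap (X m j) inferInstance) = m' at mXlt ⊢
    simp only [C_def, Set.ofPred_exists]
    refine .iUnion fun j ↦ ?_
    by_cases h : j ≤ k
    · have hs : Measurable[m'] fun ω ↦ ∑ i ∈ Finset.range j, X m i ω :=
        Finset.measurable_fun_sum _ fun i hi ↦
          mXlt (lt_of_lt_of_le (Finset.mem_range.1 hi) h)
      simp only [h, true_and]
      refine measurableSet_le ?_ measurable_const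
      exact (measurable_const (a := (1 : ℝ))).sub
        ((measurable_const.inner hs).const_mul (2 / inner ℝ u (covarianceOperator μ u) / a))
    · simp [h]
  have mono (m : ℕ) : Monotone fun j : ℕ ↦ (j / 2 ^ m : ℝ≥0) := fun i j hij ↦ by
    have : (i : ℝ≥0) ≤ j := by exact_mod_cast hij
    dsimp only
    gcongr
  have hlaw (m N : ℕ) := map_predictable_transform (P := P) (mX m)
    (hB.indep_increments.nat (mono m)) (covarianceReflection μ u).measurable
    (fun k ↦ hB.map_increment_covarianceReflection hμ hu (mono m k.le_succ)) (mC m) N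
  have hY (m j : ℕ) : Measurable fun ω ↦
      if ω ∈ C m j then X m j ω else covarianceReflection μ u (X m j ω) := by
    refine Measurable.ite ?_ (mX m j) ((covarianceReflection μ u).measurable.comp (mX m j))
    exact iSup₂_le (fun j _ ↦ (mX m j).comap_le) _ (mC m j)
  refine map_eq_of_tendsto_ae
    (U := fun m ω i ↦ ∑ j ∈ Finset.range ⌊2 ^ m * t i⌋₊,
      if ω ∈ C m j then X m j ω else covarianceReflection μ u (X m j ω))
    (V := fun m ω i ↦ ∑ j ∈ Finset.range ⌊2 ^ m * t i⌋₊, X m j ω)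
    (fun m ↦ Measurable.aemeasurable (by fun_prop)) (fun m ↦ Measurable.aemeasurable (by fun_prop))
    ?_ ?_ (.of_forall fun m ↦ ?_)
  · filter_upwards [hB.start, hB.continuous_paths, hB.gapPath_zero u a] with ω h0 hc hg
    refine tendsto_pi_nhds.2 fun i ↦ ?_
    have hsum (m j : ℕ) : ∑ i ∈ Finset.range j, X m i ω = B (j / 2 ^ m) ω - x := by
      rw [Finset.sum_range_sub (fun j : ℕ ↦ B (j / 2 ^ m) ω)]
      simp [h0]
    have hlim := ((hc.tendsto (t i)).comp (tendsto_dyadicFloor (t i))).add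
      (((tendsto_gridStopped (continuous_gapPath (μ := μ) (x := x) (u := u) (a := a) hc)
        (by rw [hg]; norm_num) (t i)).const_mul a).smul_const (covarianceOperator μ u))
    refine (hlim.sub_const (x + a • covarianceOperator μ u)).congr fun m ↦ ?_
    have hC (j : ℕ) : (∃ i ≤ j, gapPath μ x u a B ω (i / 2 ^ m) ≤ 0) ↔ ω ∈ C m j := by
      simp only [C_def, Set.mem_ofPred_eq, hsum, gapPath]
    have := sum_gridIncrements_eq (μ := μ) (w := fun j ↦ B (j / 2 ^ m) ω) (u := u) ha
      (p := fun j ↦ gapPath μ x u a B ω (j / 2 ^ m) ≤ 0) ⌊2 ^ m * t i⌋₊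
    refine Eq.trans ?_ (this.symm.trans (Finset.sum_congr rfl fun j _ ↦ if_congr (hC j) rfl rfl))
    simp [h0, dyadicFloor, gapPath]
    abel
  · filter_upwards [hB.start, hB.continuous_paths] with ω h0 hc
    refine tendsto_pi_nhds.2 fun i ↦ ?_
    refine (((hc.tendsto (t i)).comp (tendsto_dyadicFloor (t i))).sub_const x).congr fun m ↦ ?_
    rw [Finset.sum_range_sub (fun j : ℕ ↦ B (j / 2 ^ m) ω)]
    simp [h0, dyadicFloor]
  · let N := Finset.univ.sup fun i ↦ ⌊2 ^ m * t i⌋₊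
    have hN (i : Fin n) : ⌊2 ^ m * t i⌋₊ ≤ N :=
      Finset.le_sup (f := fun i ↦ ⌊2 ^ m * t i⌋₊) (Finset.mem_univ i)
    let g (w : Fin N → W) (i : Fin n) : W :=
      ∑ j : Fin ⌊2 ^ m * t i⌋₊, w (Fin.castLE (hN i) j)
    have hg : Measurable g := by fun_prop
    have := congrArg (Measure.map g) (hlaw m N)
    rw [Measure.map_map hg (measurable_pi_lambda _ fun j : Fin N ↦ hY m j),
      Measure.map_map hg (by fun_prop)] at this
    simpa [Function.comp_def, g, Finset.sum_range] using this

theorem IsBanachBrownianMotion.mirrorProcess [IsProbabilityMeasure P]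
    (hμ : IsCenteredNondegenerateGaussian μ) (hB : IsBanachBrownianMotion μ x B P) {u : W}
    (hu : u ≠ 0) {a : ℝ} (ha : a ≠ 0) :
    IsBanachBrownianMotion μ (x + a • covarianceOperator μ u) (mirrorProcess μ x u a B) P := by
  refine hB.of_sameFiniteDimLaws (measurable_mirrorProcess hB.measurable u a) ?_
    (hB.sameFiniteDimLaws_mirrorProcess hμ hu ha)
  filter_upwards [hB.continuous_paths, hB.gapPath_zero u a] with ω hc hg
  have := continuous_stoppedPath (continuous_gapPath (μ := μ) (x := x) (u := u) (a := a) hc)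
    (by rw [hg]; norm_num)
  unfold _root_.mirrorProcess
  fun_prop

end Step

/-! ### Tail bounds from the reflection principle -/

theorem gaussianReal_abs_le_one_le {v : ℝ≥0} (hv : v ≠ 0) :
    gaussianReal 0 v {z | |z| ≤ 1} ≤ ENNReal.ofReal (2 * (√(2 * Real.pi * v))⁻¹) := by
  have hset : {z : ℝ | |z| ≤ 1} = Set.Icc (-1) 1 := by ext z; simp [abs_le]
  rw [gaussianReal_apply 0 hv, hset]
  calc ∫⁻ z in Set.Icc (-1) 1, gaussianPDF 0 v z
      ≤ ∫⁻ z in Set.Icc (-1 : ℝ) 1, ENNReal.ofReal (√(2 * Real.pi * v))⁻¹ := by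
        refine lintegral_mono fun z ↦ ENNReal.ofReal_le_ofReal ?_
        rw [gaussianPDFReal]
        refine mul_le_of_le_one_right (by positivity) (Real.exp_le_one_iff.2 ?_)
        rw [neg_div]
        exact neg_nonpos.2 (by positivity)
    _ = ENNReal.ofReal (2 * (√(2 * Real.pi * v))⁻¹) := by
        rw [setLIntegral_const, Real.volume_Icc, ← ENNReal.ofReal_mul (by positivity)]
        congr 1
        ring

theorem tendsto_gaussianReal_abs_le_one :
    Tendsto (fun v : ℝ≥0 ↦ gaussianReal 0 v {z | |z| ≤ 1}) atTop (𝓝 0) := by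
  have h1 : Tendsto (fun v : ℝ≥0 ↦ 2 * (√(2 * Real.pi * v))⁻¹) atTop (𝓝 (2 * 0)) := by
    refine (tendsto_inv_atTop_zero.comp (Real.tendsto_sqrt_atTop.comp ?_)).const_mul 2
    exact (NNReal.tendsto_coe_atTop.2 tendsto_id).const_mul_atTop (by positivity)
  have h2 := ENNReal.tendsto_ofReal h1
  rw [mul_zero, ENNReal.ofReal_zero] at h2
  refine tendsto_of_tendsto_of_tendsto_of_le_of_le' tendsto_const_nhds h2
    (.of_forall fun _ ↦ zero_le) ?_
  filter_upwards [eventually_gt_atTop 0] with v hv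
  exact gaussianReal_abs_le_one_le hv.ne'

theorem tendsto_gaussianReal_le_abs :
    Tendsto (fun v : ℝ≥0 ↦ gaussianReal 0 v {z | (v : ℝ) ≤ |z|}) atTop (𝓝 0) := by
  have h1 : Tendsto (fun v : ℝ≥0 ↦ ((v : ℝ))⁻¹) atTop (𝓝 0) :=
    tendsto_inv_atTop_zero.comp (NNReal.tendsto_coe_atTop.2 tendsto_id)
  have h2 := ENNReal.tendsto_ofReal h1
  rw [ENNReal.ofReal_zero] at h2
  refine tendsto_of_tendsto_of_tendsto_of_le_of_le' tendsto_const_nhds h2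
    (.of_forall fun _ ↦ zero_le) ?_
  filter_upwards [eventually_gt_atTop 0] with v hv
  have h := meas_ge_le_variance_div_sq (μ := gaussianReal 0 v) (X := fun z ↦ z)
    (memLp_id_gaussianReal 2) (c := v) (by exact_mod_cast hv)
  rw [variance_fun_id_gaussianReal, integral_id_gaussianReal] at h
  simp only [sub_zero] at h
  refine h.trans_eq ?_
  have : (v : ℝ) ≠ 0 := by exact_mod_cast hv.ne'
  congr 1
  field_simp

/-- A bound, uniform over all reflections, on the probability that the gap between a Brownian
motion and its mirror image exceeds `1 + M` times its initial size. -/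
noncomputable def mirrorTail (M : ℝ≥0) : ENNReal :=
  gaussianReal 0 M {z | |z| ≤ 1} + 2 * gaussianReal 0 M {z | (M : ℝ) ≤ |z|}

theorem tendsto_mirrorTail : Tendsto mirrorTail atTop (𝓝 0) := by
  have h := tendsto_gaussianReal_abs_le_one.add
    (ENNReal.Tendsto.const_mul tendsto_gaussianReal_le_abs (.inr (by simp)) (a := 2))
  simp only [mul_zero, add_zero] at h
  exact h

section Step

variable {W : Type*} [NormedAddCommGroup W] [InnerProductSpace ℝ W] [CompleteSpace W]
  [SecondCountableTopology W] [MeasurableSpace W] [BorelSpace W] {μ : Measure W}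
  {Ω : Type*} [MeasurableSpace Ω] {P : Measure Ω} {x : W} {B : ℝ≥0 → Ω → W}

theorem gapPath_eq_one_add (u : W) (a : ℝ) (ω : Ω) (t : ℝ≥0) :
    gapPath μ x u a B ω t = 1 + (gapPath μ x u 1 B ω t - 1) / a := by
  simp only [gapPath]
  ring

theorem IsBanachBrownianMotion.map_gapPath (hμ : IsCenteredNondegenerateGaussian μ)
    (hB : IsBanachBrownianMotion μ x B P) {u : W} (hu : u ≠ 0) {t v : ℝ≥0}
    (hv : (v : ℝ) = 4 * t / inner ℝ u (covarianceOperator μ u)) :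
    P.map (fun ω ↦ gapPath μ x u 1 B ω t - 1) = gaussianReal 0 v := by
  have := hμ.gaussian
  have hpos := hμ.inner_covarianceOperator_pos hu
  have mB := hB.measurable
  set c : ℝ := -(2 / inner ℝ u (covarianceOperator μ u)) with hc
  have h1 : (fun ω ↦ gapPath μ x u 1 B ω t - 1) =ᵐ[P]
      (fun w ↦ c * innerSL ℝ u w) ∘ fun ω ↦ B t ω - B 0 ω := by
    filter_upwards [hB.start] with ω hω
    simp [gapPath, hω, hc]
  have h2 : ((fun w ↦ c * innerSL ℝ u w) ∘ fun w : W ↦ √((t : ℝ) - ((0 : ℝ≥0) : ℝ)) • w) =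
      (fun z ↦ (c * √t) * z) ∘ innerSL ℝ u := by
    funext w
    simp [inner_smul_right]
    ring
  rw [Measure.map_congr h1, ← Measure.map_map (by fun_prop) (by fun_prop),
    (hB.law_increment 0 t zero_le).map_eq, Measure.map_map (by fun_prop) (by fun_prop), h2,
    ← Measure.map_map (by fun_prop) (by fun_prop), IsGaussian.map_eq_gaussianReal,
    gaussianReal_map_const_mul]
  have hmean := hμ.mean_eq_zero (innerSL ℝ u)
  have hvar : Var[innerSL ℝ u; μ] = inner ℝ u (covarianceOperator μ u) := by
    simpa using hμ.variance_inner u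
  rw [hmean, mul_zero, hvar]
  congr 1
  ext
  rw [hv]
  simp only [NNReal.coe_mul, NNReal.coe_mk, Real.coe_toNNReal _ hpos.le, hc, mul_pow,
    Real.sq_sqrt t.coe_nonneg]
  field_simp
  ring

/-- The mirror process has the law of `B` up to the shift of the starting point. Evaluated at the
functional `⟪u, ·⟫`, this compares `gap - 2 * stopped gap` with `gap - 2`. -/
theorem IsBanachBrownianMotion.measure_mirror_pos [IsProbabilityMeasure P]
    (hμ : IsCenteredNondegenerateGaussian μ) (hB : IsBanachBrownianMotion μ x B P) {u : W}
    (hu : u ≠ 0) {a : ℝ} (ha : a ≠ 0) (T : ℝ≥0) :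
    P {ω | 0 < gapPath μ x u a B ω T - 2 * stoppedPath (gapPath μ x u a B ω) T} =
      P {ω | 2 < gapPath μ x u a B ω T} := by
  have mB := hB.measurable
  have hpos := hμ.inner_covarianceOperator_pos hu
  let g : (Fin 1 → W) → ℝ := fun w ↦
    -1 - 2 / inner ℝ u (covarianceOperator μ u) / a * inner ℝ u (w 0)
  have hg : Measurable g := by fun_prop
  have mM := fun t ↦ measurable_mirrorProcess (μ := μ) (x := x) mB u a t
  have h := (hB.sameFiniteDimLaws_mirrorProcess hμ hu ha).map_comp
    (fun t ↦ (mM t).sub_const _) (fun t ↦ (mB t).sub_const x) ![T] hg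
  have h' := congrArg (fun m ↦ m (Set.Ioi 0)) h
  have m1 : Measurable fun ω ↦ g fun i ↦ _root_.mirrorProcess μ x u a B (![T] i) ω -
      (x + a • covarianceOperator μ u) :=
    hg.comp (measurable_pi_lambda _ fun i ↦ (mM _).sub_const _)
  have m2 : Measurable fun ω ↦ g fun i ↦ B (![T] i) ω - x :=
    hg.comp (measurable_pi_lambda _ fun i ↦ (mB _).sub_const _)
  rw [Measure.map_apply m1 measurableSet_Ioi, Measure.map_apply m2 measurableSet_Ioi] at h'
  convert h' using 2
  · ext ω
    simp only [g, gapPath, _root_.mirrorProcess, Set.mem_preimage, Set.mem_Ioi, Set.mem_ofPred_eq,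
      Matrix.cons_val_zero, inner_sub_right, inner_add_right, inner_smul_right]
    apply iff_of_eq
    congr 1
    field_simp
    ring
  · ext ω
    simp only [g, gapPath, Set.mem_preimage, Set.mem_Ioi, Set.mem_ofPred_eq,
      Matrix.cons_val_zero]
    constructor <;> intro h <;> linarith

/-- Reflection principle: hitting a level by time `T` is at most twice as likely as being beyond
the level at time `T`. The level is `-a`, and the path that hits it is `gapPath μ x u 1 B ω - 1`:
the gap for the starting point `x + a • Q u` vanishes exactly when this happens. -/
theorem IsBanachBrownianMotion.measure_hitsBy_le [IsProbabilityMeasure P]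
    (hμ : IsCenteredNondegenerateGaussian μ) (hB : IsBanachBrownianMotion μ x B P) {u : W}
    (hu : u ≠ 0) {a : ℝ} (ha : a ≠ 0) (T : ℝ≥0) :
    P {ω | HitsBy (gapPath μ x u a B ω) T} ≤
      2 * P.map (fun ω ↦ gapPath μ x u 1 B ω T - 1) {z | |a| ≤ |z|} := by
  have ha' : 0 < |a| := abs_pos.2 ha
  rw [Measure.map_apply ((measurable_gapPath hB.measurable u 1 T).sub_const 1)
    (measurableSet_le measurable_const (by fun_prop)), two_mul]
  calc P {ω | HitsBy (gapPath μ x u a B ω) T}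
      ≤ P ({ω | gapPath μ x u a B ω T ≤ 0} ∪
          {ω | 0 < gapPath μ x u a B ω T - 2 * stoppedPath (gapPath μ x u a B ω) T}) := by
        refine measure_mono fun ω hω ↦ ?_
        simp only [Set.mem_ofPred_eq] at hω
        simp only [Set.mem_union, Set.mem_ofPred_eq, stoppedPath, if_pos hω]
        rcases le_or_gt (gapPath μ x u a B ω T) 0 with h | h
        · exact Or.inl h
        · exact Or.inr (by linarith)
    _ ≤ P {ω | gapPath μ x u a B ω T ≤ 0} + P {ω | 2 < gapPath μ x u a B ω T} := by
        rw [← hB.measure_mirror_pos hμ hu ha]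
        exact measure_union_le _ _
    _ ≤ _ := by
        refine add_le_add (measure_mono fun ω hω ↦ ?_) (measure_mono fun ω hω ↦ ?_)
        all_goals
          simp only [Set.mem_ofPred_eq, Set.mem_preimage] at hω ⊢
          rw [gapPath_eq_one_add] at hω
          have h1 : 1 ≤ |(gapPath μ x u 1 B ω T - 1) / a| := le_abs.2 (by
            first
            | exact Or.inl (by linarith)
            | exact Or.inr (by linarith))
          rwa [abs_div, le_div_iff₀ ha', one_mul] at h1

/-- Reflection principle: the probability of not hitting the level `-a` by time `T` is at most that
of being within `[-|a|, |a|]` at time `T`. -/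
theorem IsBanachBrownianMotion.measure_not_hitsBy_le [IsProbabilityMeasure P]
    (hμ : IsCenteredNondegenerateGaussian μ) (hB : IsBanachBrownianMotion μ x B P) {u : W}
    (hu : u ≠ 0) {a : ℝ} (ha : a ≠ 0) (T : ℝ≥0) :
    P {ω | ¬ HitsBy (gapPath μ x u a B ω) T} ≤
      P.map (fun ω ↦ gapPath μ x u 1 B ω T - 1) {z | |z| ≤ |a|} := by
  have ha' : 0 < |a| := abs_pos.2 ha
  have mg := measurable_gapPath (μ := μ) (x := x) hB.measurable u a
  rw [Measure.map_apply ((measurable_gapPath hB.measurable u 1 T).sub_const 1)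
    (measurableSet_le (by fun_prop) measurable_const)]
  have hset : (fun ω ↦ gapPath μ x u 1 B ω T - 1) ⁻¹' {z | |z| ≤ |a|} =
      {ω | 0 ≤ gapPath μ x u a B ω T} \ {ω | 2 < gapPath μ x u a B ω T} := by
    ext ω
    rw [Set.mem_sdiff]
    simp only [Set.mem_preimage, Set.mem_ofPred_eq, not_lt]
    rw [gapPath_eq_one_add (μ := μ) (a := a), ← div_le_one ha', ← abs_div, abs_le]
    constructor <;> rintro ⟨h1, h2⟩ <;> constructor <;> linarith
  have hsub : {ω | 2 < gapPath μ x u a B ω T} ⊆ {ω | 0 ≤ gapPath μ x u a B ω T} :=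
    Set.ofPred_subset_ofPred.2 fun ω hω ↦ zero_le_two.trans (le_of_lt hω)
  rw [hset, measure_sdiff hsub
    (measurableSet_lt measurable_const (mg T)).nullMeasurableSet (measure_ne_top _ _),
    ← hB.measure_mirror_pos hμ hu ha]
  refine ENNReal.le_sub_of_add_le_right (measure_ne_top _ _) ?_
  rw [← measure_union₀]
  · refine measure_mono_ae ?_
    filter_upwards [hB.continuous_paths] with ω hc hω
    have hcg := continuous_gapPath (μ := μ) (x := x) (u := u) (a := a) hc
    by_cases h : HitsBy (gapPath μ x u a B ω) T
    · rcases hω with hω | hω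
      · exact absurd h hω
      · simp only [stoppedPath, Set.mem_ofPred_eq, if_pos h] at hω
        exact le_of_lt (by linarith)
    · exact nonneg_of_not_hitsBy hcg h
  · exact (measurableSet_lt measurable_const
      ((mg T).sub ((measurable_stoppedPath mg T).const_mul 2))).nullMeasurableSet
  · refine measure_mono_null (t := {ω | ¬ Continuous fun t ↦ B t ω}) ?_ hB.continuous_paths
    rintro ω ⟨h1, h2⟩ hc
    have hcg := continuous_gapPath (μ := μ) (x := x) (u := u) (a := a) hc
    have := nonneg_of_not_hitsBy hcg h1
    simp only [Set.mem_ofPred_eq] at h1 h2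
    simp only [stoppedPath, if_neg h1] at h2
    linarith

theorem IsBanachBrownianMotion.ae_exists_hitsBy [IsProbabilityMeasure P]
    (hμ : IsCenteredNondegenerateGaussian μ) (hB : IsBanachBrownianMotion μ x B P) {u : W}
    (hu : u ≠ 0) : ∀ᵐ ω ∂P, ∃ T, HitsBy (gapPath μ x u 1 B ω) T := by
  have hpos := hμ.inner_covarianceOperator_pos hu
  have hle (v : ℝ≥0) : P {ω | ¬ ∃ T, HitsBy (gapPath μ x u 1 B ω) T} ≤
      gaussianReal 0 v {z | |z| ≤ 1} := by
    let T : ℝ≥0 := ⟨v * inner ℝ u (covarianceOperator μ u) / 4, by positivity⟩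
    have hT : (v : ℝ) = 4 * T / inner ℝ u (covarianceOperator μ u) := by
      change (v : ℝ) = 4 * (v * inner ℝ u (covarianceOperator μ u) / 4) / _
      field_simp
    rw [← hB.map_gapPath hμ hu (t := T) (v := v) hT]
    refine (measure_mono fun ω hω ↦ ?_).trans
      ((hB.measure_not_hitsBy_le hμ hu one_ne_zero T).trans_eq (by rw [abs_one]))
    exact fun h ↦ hω ⟨T, h⟩
  exact nonpos_iff_eq_zero.1 (ge_of_tendsto' tendsto_gaussianReal_abs_le_one hle)

/-- Up to a large time `T` the gap is unlikely to grow by `M`, and after `T` it is likely to be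
closed; the time scale at which the variance of the gap is `M` balances both. -/
theorem IsBanachBrownianMotion.measure_stoppedPath_le [IsProbabilityMeasure P]
    (hμ : IsCenteredNondegenerateGaussian μ) (hB : IsBanachBrownianMotion μ x B P) {u : W}
    (hu : u ≠ 0) {M : ℝ≥0} (hM : 0 < M) :
    P {ω | ¬ ∀ t, |stoppedPath (gapPath μ x u 1 B ω) t| ≤ 1 + M} ≤ mirrorTail M := by
  have hpos := hμ.inner_covarianceOperator_pos hu
  have hM' : (0 : ℝ) < M := by exact_mod_cast hM
  -- At this time the gap has variance `M`.
  let T : ℝ≥0 := ⟨M * inner ℝ u (covarianceOperator μ u) / 4, by positivity⟩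
  have hT : (M : ℝ) = 4 * T / inner ℝ u (covarianceOperator μ u) := by
    change (M : ℝ) = 4 * (M * inner ℝ u (covarianceOperator μ u) / 4) / _
    field_simp
  have h1 := hB.measure_not_hitsBy_le hμ hu one_ne_zero T
  have h2 := hB.measure_hitsBy_le hμ hu (a := -M) (by simpa using hM'.ne') T
  rw [hB.map_gapPath hμ hu (t := T) (v := M) hT] at h1 h2
  rw [abs_one] at h1
  rw [abs_neg, abs_of_pos hM'] at h2
  refine le_trans ?_ ((measure_union_le _ _).trans (add_le_add h1 h2))
  refine measure_mono_ae ?_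
  filter_upwards [hB.continuous_paths, hB.gapPath_zero u 1] with ω hc hz hω
  have hcg := continuous_gapPath (μ := μ) (x := x) (u := u) (a := 1) hc
  have hcg' := continuous_gapPath (μ := μ) (x := x) (u := u) (a := -M) hc
  by_contra hcon
  replace hcon : ¬ ((¬ HitsBy (gapPath μ x u 1 B ω) T) ∨ HitsBy (gapPath μ x u (-M) B ω) T) := hcon
  push Not at hcon
  refine hω fun t ↦ ?_
  by_cases ht : HitsBy (gapPath μ x u 1 B ω) t
  · rw [stoppedPath, if_pos ht, abs_zero]
    positivity
  · have hnn := nonneg_of_not_hitsBy hcg ht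
    rw [stoppedPath, if_neg ht, abs_of_nonneg hnn]
    have htT : t ≤ T := by
      by_contra! h
      exact ht (hcon.1.mono h.le)
    have h3 := nonneg_of_not_hitsBy hcg' (fun h ↦ hcon.2 (h.mono htT))
    rw [gapPath_eq_one_add, div_neg, ← sub_eq_add_neg, sub_nonneg, div_le_one hM'] at h3
    linarith

/-- The coupling of two Brownian motions whose starting points differ by an element of the range
of the covariance operator. -/
theorem IsBanachBrownianMotion.exists_mirror_coupling [IsProbabilityMeasure P]
    (hμ : IsCenteredNondegenerateGaussian μ) (hB : IsBanachBrownianMotion μ x B P) {h : W}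
    (hh : h ∈ (covarianceOperator μ).range) :
    ∃ B' : ℝ≥0 → Ω → W, IsBanachBrownianMotion μ (x + h) B' P ∧
      SameFiniteDimLaws (fun t ω ↦ B' t ω - (x + h)) (fun t ω ↦ B t ω - x) P ∧
      (∀ᵐ ω ∂P, Tendsto (fun t ↦ B' t ω - B t ω) atTop (𝓝 0)) ∧
      ∀ M : ℝ≥0, 0 < M →
        P {ω | ¬ ∀ t, ‖B' t ω - B t ω‖ ≤ (1 + M) * ‖h‖} ≤ mirrorTail M := by
  obtain ⟨u, rfl⟩ := hh
  rcases eq_or_ne u 0 with rfl | hu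
  · refine ⟨B, by simpa using hB, fun n t ↦ by simp, by simp, fun M _ ↦ by simp⟩
  have h1 := hB.mirrorProcess hμ hu one_ne_zero
  have h2 := hB.sameFiniteDimLaws_mirrorProcess hμ hu one_ne_zero
  rw [one_smul] at h1
  simp only [one_smul] at h2
  refine ⟨_, h1, h2, ?_, fun M hM ↦ le_trans (measure_mono fun ω hω ↦ ?_)
    (hB.measure_stoppedPath_le hμ hu hM)⟩
  · filter_upwards [hB.ae_exists_hitsBy hμ hu] with ω ⟨T, hT⟩
    simpa [_root_.mirrorProcess] using
      (tendsto_stoppedPath hT).smul_const (covarianceOperator μ u)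
  · refine fun hall ↦ hω fun t ↦ ?_
    simp only [_root_.mirrorProcess, add_sub_cancel_left, one_mul, norm_smul, Real.norm_eq_abs]
    exact mul_le_mul_of_nonneg_right (hall t) (norm_nonneg _)

end Step

/-! ### Composing infinitely many reflections -/

/-- Dominated convergence for series of which all but finitely many terms are dominated. -/
theorem tendsto_tsum_of_eventually_le {W ι : Type*} [NormedAddCommGroup W]
    [CompleteSpace W] {l : Filter ι} {f : ℕ → ι → W} {g : ℕ → W} {b : ℕ → ℝ} (hb : Summable b)
    (h : ∀ k, Tendsto (f k) l (𝓝 (g k))) {n₀ : ℕ}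
    (hle : ∀ᶠ t in l, ∀ k ≥ n₀, ‖f k t‖ ≤ b k) :
    Tendsto (fun t ↦ ∑' k, f k t) l (𝓝 (∑' k, g k)) := by
  refine tendsto_tsum_of_dominated_convergence
    (bound := fun k ↦ if k < n₀ then ‖g k‖ + 1 else b k) ?_ h ?_
  · refine (summable_nat_add_iff n₀).1 (((summable_nat_add_iff n₀).2 hb).congr fun k ↦ ?_)
    simp
  · have h1 : ∀ᶠ t in l, ∀ k ∈ Finset.range n₀, ‖f k t‖ < ‖g k‖ + 1 :=
      (Finset.eventually_all _).2 fun k _ ↦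
        (h k).norm.eventually_lt_const (lt_add_one _)
    filter_upwards [h1, hle] with t ht hle k
    split_ifs with hk
    · exact (ht k (Finset.mem_range.2 hk)).le
    · exact hle k (not_lt.1 hk)

/-- Any vector is the limit of sums of a rapidly decreasing sequence of elements of a dense
subspace, where the rate is prescribed in advance. -/
theorem exists_tendsto_sum_of_topologicalClosure_eq_top {W : Type*} [NormedAddCommGroup W]
    [NormedSpace ℝ W] {S : Submodule ℝ W} (hS : S.topologicalClosure = ⊤) (z : W) {b : ℕ → ℝ}
    (hb : ∀ n, 0 < b n) :
    ∃ v : ℕ → W, Tendsto (fun n ↦ ∑ i ∈ Finset.range n, v i) atTop (𝓝 z) ∧ (∀ n, v n ∈ S) ∧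
      ∀ n > 0, ‖v n‖ < b n := by
  have hz : z ∈ closure (S.toAddSubgroup : Set W) := by
    have : z ∈ S.topologicalClosure := hS ▸ Submodule.mem_top
    exact this
  obtain ⟨v, h1, h2, -, h3⟩ := controlled_sum_of_mem_closure hz hb
  exact ⟨v, (tendsto_add_atTop_iff_nat 1).1 h1, h2, h3⟩

section Chain

variable {W : Type*} [NormedAddCommGroup W] [InnerProductSpace ℝ W] [CompleteSpace W]
  [SecondCountableTopology W] [MeasurableSpace W] [BorelSpace W] {μ : Measure W}
  {Ω : Type*} [MeasurableSpace Ω] {P : Measure Ω} {x : W} {B : ℝ≥0 → Ω → W}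

/-- Successive reflections move the starting point by `v 0, v 1, …` in turn. -/
theorem IsBanachBrownianMotion.exists_mirror_sequence [IsProbabilityMeasure P]
    (hμ : IsCenteredNondegenerateGaussian μ) (hB : IsBanachBrownianMotion μ x B P) {v : ℕ → W}
    (hv : ∀ n, v n ∈ (covarianceOperator μ).range) :
    ∃ C : ℕ → ℝ≥0 → Ω → W, C 0 = B ∧ ∀ n,
      IsBanachBrownianMotion μ (x + ∑ i ∈ Finset.range n, v i) (C n) P ∧
      SameFiniteDimLaws (fun t ω ↦ C n t ω - (x + ∑ i ∈ Finset.range n, v i))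
        (fun t ω ↦ B t ω - x) P ∧
      (∀ᵐ ω ∂P, Tendsto (fun t ↦ C (n + 1) t ω - C n t ω) atTop (𝓝 0)) ∧
      ∀ M : ℝ≥0, 0 < M →
        P {ω | ¬ ∀ t, ‖C (n + 1) t ω - C n t ω‖ ≤ (1 + M) * ‖v n‖} ≤ mirrorTail M := by
  let S (n : ℕ) := {C : ℝ≥0 → Ω → W //
    IsBanachBrownianMotion μ (x + ∑ i ∈ Finset.range n, v i) C P ∧
      SameFiniteDimLaws (fun t ω ↦ C t ω - (x + ∑ i ∈ Finset.range n, v i))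
        (fun t ω ↦ B t ω - x) P}
  have step (n : ℕ) (C : S n) : ∃ C' : S (n + 1),
      (∀ᵐ ω ∂P, Tendsto (fun t ↦ C'.1 t ω - C.1 t ω) atTop (𝓝 0)) ∧
      ∀ M : ℝ≥0, 0 < M →
        P {ω | ¬ ∀ t, ‖C'.1 t ω - C.1 t ω‖ ≤ (1 + M) * ‖v n‖} ≤ mirrorTail M := by
    obtain ⟨C', h1, h2, h3, h4⟩ := C.2.1.exists_mirror_coupling hμ (hv n)
    rw [add_assoc, ← Finset.sum_range_succ] at h1 h2
    exact ⟨⟨C', h1, h2.trans C.2.2⟩, h3, h4⟩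
  choose next hnext using step
  let C (n : ℕ) : S n := Nat.rec ⟨B, by simpa using hB, fun n t ↦ by simp⟩ next n
  exact ⟨fun n ↦ (C n).1, rfl, fun n ↦ ⟨(C n).2.1, (C n).2.2, hnext n (C n)⟩⟩

/-- Every Brownian motion on any probability space is coupled at infinity with a Brownian motion
started at any other point. -/
theorem IsBanachBrownianMotion.exists_coupleAtInfinity [IsProbabilityMeasure P]
    (hμ : IsCenteredNondegenerateGaussian μ) (hB : IsBanachBrownianMotion μ x B P) (y : W) :
    ∃ B' : ℝ≥0 → Ω → W, IsBanachBrownianMotion μ y B' P ∧ CoupleAtInfinity B B' P := by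
  classical
  -- The displacements are chosen so small that the `n`-th gap stays below `2 ^ (-n)` except on an
  -- event of probability at most `2 ^ (-n)`.
  have hM (n : ℕ) : ∃ M : ℝ≥0, 0 < M ∧ mirrorTail M ≤ 2⁻¹ ^ n :=
    ((eventually_gt_atTop 0).and
      (tendsto_mirrorTail.eventually_le_const (ENNReal.pow_pos (by simp) n))).exists
  choose M M_pos hM using hM
  obtain ⟨v, hlim, hv, hvb⟩ := exists_tendsto_sum_of_topologicalClosure_eq_top
    hμ.range_covarianceOperator_dense (y - x) (b := fun n ↦ (1 / 2) ^ n / (1 + M n))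
    (fun n ↦ by positivity)
  obtain ⟨C, rfl, hC⟩ := hB.exists_mirror_sequence hμ hv
  have htail : ∀ᵐ ω ∂P, ∀ᶠ n in atTop, ∀ t, ‖C (n + 1) t ω - C n t ω‖ ≤ (1 / 2) ^ n := by
    have hsum : ∑' n, P {ω | ¬ ∀ t, ‖C (n + 1) t ω - C n t ω‖ ≤ (1 + M n) * ‖v n‖} ≠ ⊤ := by
      refine ne_top_of_le_ne_top ?_
        (ENNReal.tsum_le_tsum fun n ↦ ((hC n).2.2.2 (M n) (M_pos n)).trans (hM n))
      rw [ENNReal.tsum_geometric]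
      simp
    filter_upwards [ae_eventually_notMem hsum] with ω hω
    filter_upwards [hω, eventually_gt_atTop 0] with n hn hpos t
    have hn' : ∀ t, ‖C (n + 1) t ω - C n t ω‖ ≤ (1 + M n) * ‖v n‖ := not_not.1 hn
    refine (hn' t).trans ?_
    have := (hvb n hpos).le
    rwa [le_div_iff₀ (by positivity), mul_comm] at this
  have hgood : ∀ᵐ ω ∂P, (∀ n, Continuous fun t ↦ C n t ω) ∧
      (∀ n, Tendsto (fun t ↦ C (n + 1) t ω - C n t ω) atTop (𝓝 0)) ∧
      ∃ n₀, ∀ n ≥ n₀, ∀ t, ‖C (n + 1) t ω - C n t ω‖ ≤ (1 / 2) ^ n := by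
    filter_upwards [ae_all_iff.2 fun n ↦ (hC n).1.continuous_paths,
      ae_all_iff.2 fun n ↦ (hC n).2.2.1, htail] with ω h1 h2 h3
    exact ⟨h1, h2, eventually_atTop.1 h3⟩
  -- A measurable null set outside of which everything converges, so that the limit process is
  -- measurable without completing the probability space.
  obtain ⟨N, hN, mN, hN0⟩ := exists_measurable_superset_of_null hgood
  have good {ω : Ω} (hω : ω ∉ N) := not_not.1 fun h ↦ hω (hN h)
  let B' (t : ℝ≥0) (ω : Ω) : W := if ω ∈ N then 0 else C 0 t ω + ∑' n, (C (n + 1) t ω - C n t ω)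
  have hconv {ω : Ω} (hω : ω ∉ N) (t : ℝ≥0) :
      Tendsto (fun n ↦ C n t ω) atTop (𝓝 (B' t ω)) := by
    obtain ⟨-, -, n₀, hn₀⟩ := good hω
    simp only [B', if_neg hω]
    have hs := (Summable.of_norm_bounded_eventually_nat summable_geometric_two
      (eventually_atTop.2 ⟨n₀, fun k hk ↦ hn₀ k hk t⟩)).hasSum
    refine (hs.tendsto_sum_nat.const_add (C 0 t ω)).congr fun n ↦ ?_
    rw [Finset.sum_range_sub (fun n ↦ C n t ω)]
    abel
  have hNae : ∀ᵐ ω ∂P, ω ∉ N := measure_eq_zero_iff_ae_notMem.1 hN0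
  have mC (n : ℕ) (t : ℝ≥0) : Measurable (C n t) := (hC n).1.measurable t
  refine ⟨B', hB.of_sameFiniteDimLaws (fun t ↦ ?_) ?_ fun n t ↦ ?_, ?_⟩
  · refine measurable_of_tendsto_metrizable (f := fun n ω ↦ if ω ∈ N then 0 else C n t ω)
      (fun n ↦ Measurable.ite mN measurable_const (mC n t)) (tendsto_pi_nhds.2 fun ω ↦ ?_)
    by_cases hω : ω ∈ N
    · simp [hω, B']
    · simpa [hω] using hconv hω t
  · filter_upwards [hNae] with ω hω
    obtain ⟨hc, -, n₀, hn₀⟩ := good hω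
    simp only [B', if_neg hω]
    refine (hc 0).add (continuous_iff_continuousAt.2 fun t ↦ ?_)
    exact tendsto_tsum_of_eventually_le summable_geometric_two
      (fun k ↦ ((hc (k + 1)).sub (hc k)).continuousAt) (.of_forall fun t k hk ↦ hn₀ k hk t)
  · refine map_eq_of_tendsto_ae
      (U := fun m ω i ↦ C m (t i) ω - (x + ∑ i ∈ Finset.range m, v i))
      (V := fun _ ω i ↦ C 0 (t i) ω - x)
      (fun m ↦ Measurable.aemeasurable (by fun_prop))
      (fun m ↦ Measurable.aemeasurable (by fun_prop)) ?_ (.of_forall fun ω ↦ tendsto_const_nhds)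
      (.of_forall fun m ↦ (hC m).2.1 n t)
    filter_upwards [hNae] with ω hω
    refine tendsto_pi_nhds.2 fun i ↦ ?_
    simpa using (hconv hω (t i)).sub (hlim.const_add x)
  · filter_upwards [hNae] with ω hω
    obtain ⟨-, hz, n₀, hn₀⟩ := good hω
    have := tendsto_tsum_of_eventually_le summable_geometric_two hz
      (.of_forall fun t k hk ↦ hn₀ k hk t)
    simp only [B', if_neg hω, add_sub_cancel_left]
    simpa using this.norm

end Chain

/-! ### Linear combinations of independent Gaussian vectors -/

/-- The standard inner product on finitely supported families. -/
noncomputable def finsuppInner {ι : Type*} : (ι →₀ ℝ) →ₗ[ℝ] (ι →₀ ℝ) →ₗ[ℝ] ℝ :=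
  Finsupp.linearCombination ℝ fun p ↦ Finsupp.lapply p

theorem finsuppInner_apply {ι : Type*} (c d : ι →₀ ℝ) {s : Finset ι} (hs : c.support ⊆ s) :
    finsuppInner c d = ∑ p ∈ s, c p * d p := by
  rw [finsuppInner, Finsupp.linearCombination_apply, Finsupp.sum_of_support_subset _ hs _ (by simp)]
  simp

theorem finsuppInner_single_left {ι : Type*} (p : ι) (a : ℝ) (d : ι →₀ ℝ) :
    finsuppInner (Finsupp.single p a) d = a * d p := by
  simp [finsuppInner]

theorem finsuppInner_single_right {ι : Type*} (c : ι →₀ ℝ) (p : ι) (a : ℝ) :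
    finsuppInner c (Finsupp.single p a) = c p * a := by
  classical
  rw [finsuppInner_apply c _ (Finset.subset_insert p c.support),
    Finset.sum_eq_single_of_mem p (Finset.mem_insert_self _ _)]
  · simp
  · intro q _ hq
    rw [Finsupp.single_eq_of_ne hq, mul_zero]

section Combination

variable {W : Type*} [NormedAddCommGroup W] [InnerProductSpace ℝ W] [CompleteSpace W]
  [SecondCountableTopology W] [MeasurableSpace W] [BorelSpace W] {μ : Measure W}
  {Ω : Type*} [MeasurableSpace Ω] {P : Measure Ω} {ι : Type*} {Z : ι → Ω → W}

/-- Finitely many linear combinations of independent Gaussian vectors are jointly Gaussian. -/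
theorem hasGaussianLaw_linearCombination [IsProbabilityMeasure P]
    (hμ : IsCenteredNondegenerateGaussian μ) (hZ : ∀ p, HasLaw (Z p) μ P) (hi : iIndepFun Z P)
    {κ : Type*} [Finite κ] (c : κ → ι →₀ ℝ) :
    HasGaussianLaw (fun ω i ↦ Finsupp.linearCombination ℝ (Z · ω) (c i)) P := by
  classical
  have := hμ.gaussian
  cases nonempty_fintype κ
  let S : Finset ι := Finset.univ.biUnion fun i ↦ (c i).support
  have hS (i : κ) : (c i).support ⊆ S :=
    Finset.subset_biUnion_of_mem (fun i ↦ (c i).support) (Finset.mem_univ i)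
  have hG : HasGaussianLaw (fun ω (p : S) ↦ Z p ω) P :=
    (hi.precomp Subtype.val_injective).hasGaussianLaw fun p ↦ (hZ p).hasGaussianLaw
  let L : (S → W) →L[ℝ] κ → W :=
    ContinuousLinearMap.pi fun i ↦ ∑ p : S, c i p • ContinuousLinearMap.proj p
  suffices h : (fun ω i ↦ Finsupp.linearCombination ℝ (Z · ω) (c i)) = L ∘ fun ω (p : S) ↦ Z p ω by
    rw [h]
    exact hG.map L
  funext ω i
  rw [Finsupp.linearCombination_apply, Finsupp.sum_of_support_subset _ (hS i) _ (by simp)]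
  simp only [L, Function.comp_apply, ContinuousLinearMap.coe_pi', sum_apply,
    smul_apply, ContinuousLinearMap.proj_apply]
  exact (Finset.sum_coe_sort S fun p ↦ c i p • Z p ω).symm

/-- Under linear combinations of independent vectors of law `μ`, covariances are those of `μ` times
the inner product of the coefficients. -/
theorem covariance_linearCombination [IsProbabilityMeasure P]
    (hμ : IsCenteredNondegenerateGaussian μ) (hZ : ∀ p, HasLaw (Z p) μ P) (hi : iIndepFun Z P)
    (c d : ι →₀ ℝ) (u v : W) :
    cov[fun ω ↦ inner ℝ u (Finsupp.linearCombination ℝ (Z · ω) c),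
      fun ω ↦ inner ℝ v (Finsupp.linearCombination ℝ (Z · ω) d); P] =
      finsuppInner c d * inner ℝ (covarianceOperator μ u) v := by
  classical
  have := hμ.gaussian
  have hL2 (p : ι) (w : W) : MemLp (fun ω ↦ inner ℝ w (Z p ω)) 2 P :=
    ((hZ p).hasGaussianLaw.memLp_two).const_inner w
  have hcov (p q : ι) : cov[fun ω ↦ inner ℝ u (Z p ω), fun ω ↦ inner ℝ v (Z q ω); P] =
      if p = q then inner ℝ (covarianceOperator μ u) v else 0 := by
    split_ifs with h
    · subst h
      rw [← hμ.covariance_inner]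
      exact (hZ p).covariance_fun_comp (f := fun w ↦ inner ℝ u w) (g := fun w ↦ inner ℝ v w)
        (by fun_prop) (by fun_prop)
    · refine IndepFun.covariance_eq_zero ?_ (hL2 p u) (hL2 q v)
      exact (hi.indepFun h).comp (φ := fun w ↦ inner ℝ u w) (ψ := fun w ↦ inner ℝ v w)
        (by fun_prop) (by fun_prop)
  have hsum (c : ι →₀ ℝ) (w : W) :
      (fun ω ↦ inner ℝ w (Finsupp.linearCombination ℝ (Z · ω) c)) =
        fun ω ↦ ∑ p : c.support, c p * inner ℝ w (Z p ω) := by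
    funext ω
    rw [Finsupp.linearCombination_apply, Finsupp.sum, inner_sum,
      ← Finset.sum_coe_sort c.support]
    simp [inner_smul_right]
  rw [hsum, hsum, covariance_fun_sum_fun_sum
    (X := fun (p : c.support) ω ↦ c p * inner ℝ u (Z p ω))
    (Y := fun (q : d.support) ω ↦ d q * inner ℝ v (Z q ω))
    (fun p ↦ (hL2 p u).const_mul _) (fun q ↦ (hL2 q v).const_mul _)]
  simp only [covariance_const_mul_left, covariance_const_mul_right, hcov]
  rw [finsuppInner_apply c d subset_rfl, Finset.sum_mul, ← Finset.sum_coe_sort c.support]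
  refine Finset.sum_congr rfl fun p _ ↦ ?_
  rw [Finset.sum_coe_sort d.support
    (fun q ↦ d q * (c p * if (p : ι) = q then inner ℝ (covarianceOperator μ u) v else 0))]
  simp only [mul_ite, mul_zero, Finset.sum_ite_eq, Finsupp.mem_support_iff]
  split_ifs with h
  · ring
  · simp [not_not.1 h]

theorem map_linearCombination [IsProbabilityMeasure P]
    (hμ : IsCenteredNondegenerateGaussian μ) (hZ : ∀ p, HasLaw (Z p) μ P) (hi : iIndepFun Z P)
    (c : ι →₀ ℝ) {s : ℝ} (hs : 0 ≤ s) (hc : finsuppInner c c = s) :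
    P.map (fun ω ↦ Finsupp.linearCombination ℝ (Z · ω) c) = μ.map fun w ↦ √s • w := by
  have := hμ.gaussian
  have hG : HasGaussianLaw (fun ω ↦ Finsupp.linearCombination ℝ (Z · ω) c) P :=
    (hasGaussianLaw_linearCombination hμ hZ hi fun _ : Unit ↦ c).map
      (ContinuousLinearMap.proj ())
  have := hG.isGaussian_map
  have hμs : IsGaussian (μ.map fun w ↦ √s • w) :=
    (IsGaussian.hasGaussianLaw_id (μ := μ)).map (√s • ContinuousLinearMap.id ℝ W) |>.isGaussian_map
  have hZ0 (p : ι) : ∫ ω, Z p ω ∂P = 0 := by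
    rw [(hZ p).integral_eq, hμ.integral_id_eq_zero]
  refine IsGaussian.ext ?_ ?_
  · rw [integral_map hG.aemeasurable (by fun_prop), integral_map (by fun_prop) (by fun_prop)]
    simp only [id, Finsupp.linearCombination_apply, Finsupp.sum]
    rw [integral_finsetSum (f := fun p ω ↦ c p • Z p ω) _
        fun p _ ↦ ((hZ p).hasGaussianLaw.integrable).smul (c p),
      integral_smul, hμ.integral_id_eq_zero, smul_zero]
    exact Finset.sum_eq_zero fun p _ ↦ by rw [integral_smul, hZ0, smul_zero]
  · ext u v
    rw [covarianceBilin_apply_eq_cov IsGaussian.memLp_two_id,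
      covarianceBilin_apply_eq_cov IsGaussian.memLp_two_id,
      covariance_map (by fun_prop) (by fun_prop) hG.aemeasurable,
      covariance_map (by fun_prop) (by fun_prop) (by fun_prop)]
    have h1 := covariance_linearCombination hμ hZ hi c c u v
    simp only [Function.comp_def, inner_smul_right]
    rw [h1, covariance_const_mul_left, covariance_const_mul_right, hμ.covariance_inner, hc,
      ← mul_assoc, Real.mul_self_sqrt hs]

/-- Linear combinations with orthogonal coefficient families are independent, since they are jointly
Gaussian and uncorrelated. -/
theorem map_linearCombination_pi [IsProbabilityMeasure P]
    (hμ : IsCenteredNondegenerateGaussian μ) (hZ : ∀ p, HasLaw (Z p) μ P) (hi : iIndepFun Z P)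
    {κ : Type*} [Fintype κ] (c : κ → ι →₀ ℝ) {s : κ → ℝ} (hs : ∀ i, 0 ≤ s i)
    (hc : ∀ i, finsuppInner (c i) (c i) = s i) (hc' : ∀ i j, i ≠ j → finsuppInner (c i) (c j) = 0) :
    P.map (fun ω i ↦ Finsupp.linearCombination ℝ (Z · ω) (c i)) =
      (Measure.pi fun _ ↦ μ).map fun w i ↦ √(s i) • w i := by
  have := hμ.gaussian
  have hG := hasGaussianLaw_linearCombination hμ hZ hi c
  have hind : iIndepFun (fun i ω ↦ Finsupp.linearCombination ℝ (Z · ω) (c i)) P :=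
    hG.iIndepFun_of_covariance_inner fun i j hij u v ↦ by
      rw [covariance_linearCombination hμ hZ hi, hc' i j hij, zero_mul]
  have hprob (i : κ) : IsProbabilityMeasure (μ.map fun w ↦ √(s i) • w) :=
    Measure.isProbabilityMeasure_map (by fun_prop)
  rw [(iIndepFun_iff_map_fun_eq_pi_map fun i ↦ hG.aemeasurable.eval i).1 hind]
  rw [Measure.pi_map_pi (f := fun i w ↦ √(s i) • w) fun i ↦ by fun_prop]
  congr 1
  funext i
  exact map_linearCombination hμ hZ hi (c i) (hs i) (hc i)

end Combination

/-! ### Lévy's midpoint construction: the coefficients -/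

/-- The coefficients of the Brownian increment over `[j / 2 ^ m, (j + 1) / 2 ^ m]` in the family
`Z (m, k)` of independent Gaussian vectors: an increment is halved, and the halves are corrected
by an independent Gaussian vector with opposite signs. -/
noncomputable def levyCoeff : ℕ → ℕ → (ℕ × ℕ →₀ ℝ)
  | 0, j => Finsupp.single (0, j) 1
  | m + 1, j => (1 / 2 : ℝ) • levyCoeff m (j / 2) +
      Finsupp.single (m + 1, j / 2) ((-1) ^ j * (√(1 / 2)) ^ m / 2)

theorem levyCoeff_apply_eq_zero {m n : ℕ} (h : m < n) (j k : ℕ) : levyCoeff m j (n, k) = 0 := by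
  induction m generalizing j with
  | zero =>
    rw [levyCoeff, Finsupp.single_eq_of_ne]
    simp [h.ne']
  | succ m ih =>
    rw [levyCoeff, Finsupp.add_apply, Finsupp.smul_apply, ih (by omega), Finsupp.single_eq_of_ne]
    · simp
    · simp [h.ne']

/-- At each level the increments are orthogonal with the variances of Brownian increments. -/
theorem finsuppInner_levyCoeff (m i j : ℕ) :
    finsuppInner (levyCoeff m i) (levyCoeff m j) = if i = j then (1 / 2) ^ m else 0 := by
  induction m generalizing i j with
  | zero =>
    rw [levyCoeff, levyCoeff, finsuppInner_single_left, Finsupp.single_apply]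
    simp [eq_comm]
  | succ m ih =>
    have hr : (√(1 / 2) : ℝ) ^ m * √(1 / 2) ^ m = (1 / 2) ^ m := by
      rw [← mul_pow, Real.mul_self_sqrt (by norm_num)]
    simp only [levyCoeff, map_add, LinearMap.add_apply, map_smul, LinearMap.smul_apply, ih,
      finsuppInner_single_left, finsuppInner_single_right, Finsupp.single_apply,
      levyCoeff_apply_eq_zero (Nat.lt_succ_self m), Prod.mk.injEq, true_and, smul_eq_mul]
    by_cases h : i / 2 = j / 2
    · have hsign : (-1 : ℝ) ^ i * (-1) ^ j = if i = j then 1 else -1 := by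
        rw [← pow_add]
        split_ifs with hij
        · exact Even.neg_one_pow ⟨i, by omega⟩
        · exact Odd.neg_one_pow ⟨i / 2 + j / 2, by omega⟩
      simp only [if_pos h]
      calc _ = (1 / 4) * (1 / 2 : ℝ) ^ m + ((-1) ^ i * (-1) ^ j) *
            (√(1 / 2) ^ m * √(1 / 2) ^ m) / 4 := by ring
        _ = _ := by
          rw [hr, hsign]
          split_ifs <;> ring
    · rw [if_neg h, if_neg h, if_neg fun hij ↦ h (by rw [hij])]
      simp

theorem finsuppInner_sum_levyCoeff (m : ℕ) (s t : Finset ℕ) :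
    finsuppInner (∑ i ∈ s, levyCoeff m i) (∑ j ∈ t, levyCoeff m j) =
      (s ∩ t).card * (1 / 2) ^ m := by
  simp only [map_sum, LinearMap.sum_apply, finsuppInner_levyCoeff]
  rw [Finset.sum_comm]
  simp only [Finset.sum_ite_eq]
  rw [← Finset.sum_filter, Finset.sum_const, nsmul_eq_mul, Finset.filter_mem_eq_inter,
    Finset.inter_comm]

/-! ### Lévy's midpoint construction: the paths -/

/-- The projection of the real line to the unit interval. -/
def unitClamp (v : ℝ) : ℝ := max 0 (min v 1)

theorem unitClamp_of_nonpos {v : ℝ} (h : v ≤ 0) : unitClamp v = 0 :=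
  max_eq_left ((min_le_left _ _).trans h)

theorem unitClamp_of_one_le {v : ℝ} (h : 1 ≤ v) : unitClamp v = 1 := by
  rw [unitClamp, min_eq_right h, max_eq_right zero_le_one]

theorem unitClamp_nonneg (v : ℝ) : 0 ≤ unitClamp v := le_max_left _ _

theorem unitClamp_le_one (v : ℝ) : unitClamp v ≤ 1 := max_le zero_le_one (min_le_right _ _)

theorem unitClamp_of_mem {v : ℝ} (h0 : 0 ≤ v) (h1 : v ≤ 1) : unitClamp v = v := by
  rw [unitClamp, min_eq_left h1, max_eq_right h0]

theorem unitClamp_half (v : ℝ) :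
    unitClamp v = (unitClamp (2 * v) + unitClamp (2 * v - 1)) / 2 := by
  rcases le_total v 0 with h | h
  · rw [unitClamp_of_nonpos h, unitClamp_of_nonpos (by linarith),
      unitClamp_of_nonpos (by linarith)]
    norm_num
  rcases le_total 1 v with h1 | h1
  · rw [unitClamp_of_one_le h1, unitClamp_of_one_le (by linarith),
      unitClamp_of_one_le (by linarith)]
    norm_num
  rw [unitClamp_of_mem h h1]
  rcases le_total (2 * v) 1 with h2 | h2
  · rw [unitClamp_of_mem (by linarith) h2, unitClamp_of_nonpos (by linarith)]
    ring
  · rw [unitClamp_of_one_le h2, unitClamp_of_mem (by linarith) (by linarith)]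
    ring

section Polyline

variable {W : Type*} [NormedAddCommGroup W] [NormedSpace ℝ W]

/-- The continuous path from `0` that is affine between consecutive integers, with increment `w k`
over `[k, k + 1]`. -/
noncomputable def polyline (w : ℕ → W) (u : ℝ≥0) : W :=
  ∑ k ∈ Finset.range (⌊u⌋₊ + 1), unitClamp (u - k) • w k

theorem polyline_eq_sum (w : ℕ → W) {u : ℝ≥0} {K : ℕ} (h : u ≤ K) :
    polyline w u = ∑ k ∈ Finset.range K, unitClamp (u - k) • w k := by
  have key {L : ℕ} {k : ℕ} (hL : u ≤ L) (hk : L ≤ k) : unitClamp (u - k) • w k = 0 := by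
    have h1 : (u : ℝ) ≤ L := by exact_mod_cast hL
    have h2 : (L : ℝ) ≤ k := by exact_mod_cast hk
    rw [unitClamp_of_nonpos (by linarith), zero_smul]
  have hu : u ≤ (⌊u⌋₊ + 1 : ℕ) := by exact_mod_cast (Nat.lt_floor_add_one u).le
  rw [polyline]
  rcases le_total K (⌊u⌋₊ + 1) with h1 | h1
  · refine (Finset.sum_subset (by simpa using h1) fun k _ hk ↦ key h (by simpa using hk)).symm
  · exact Finset.sum_subset (by simpa using h1) fun k _ hk ↦ key hu (by simpa using hk)

theorem polyline_natCast (w : ℕ → W) (j : ℕ) : polyline w j = ∑ k ∈ Finset.range j, w k := by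
  rw [polyline_eq_sum w le_rfl]
  refine Finset.sum_congr rfl fun k hk ↦ ?_
  have : (k : ℝ) + 1 ≤ j := by exact_mod_cast Finset.mem_range.1 hk
  rw [unitClamp_of_one_le (by simp; linarith), one_smul]

theorem continuous_polyline (w : ℕ → W) : Continuous (polyline w) := by
  refine continuous_iff_continuousAt.2 fun u ↦ ?_
  obtain ⟨K, hK⟩ := exists_nat_gt u
  have h : polyline w =ᶠ[𝓝 u] fun u ↦ ∑ k ∈ Finset.range K, unitClamp (u - k) • w k := by
    filter_upwards [eventually_lt_nhds hK] with v hv using polyline_eq_sum w hv.le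
  refine ContinuousAt.congr (Continuous.continuousAt ?_) h.symm
  unfold unitClamp
  fun_prop

/-- Refining a polyline: moving the midpoint of each segment by `d k` changes the path by a
multiple of the `d k` of the current segment. -/
theorem polyline_refine {w w' d : ℕ → W} (h0 : ∀ k, w' (2 * k) = (1 / 2 : ℝ) • w k + d k)
    (h1 : ∀ k, w' (2 * k + 1) = (1 / 2 : ℝ) • w k - d k) (u : ℝ≥0) :
    polyline w' (2 * u) - polyline w u =
      (unitClamp (2 * (u - ⌊u⌋₊)) - unitClamp (2 * (u - ⌊u⌋₊) - 1)) • d ⌊u⌋₊ := by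
  have hu : u ≤ (⌊u⌋₊ + 1 : ℕ) := by exact_mod_cast (Nat.lt_floor_add_one u).le
  have hpair (K : ℕ) (f : ℕ → W) : ∑ i ∈ Finset.range (2 * K), f i =
      ∑ k ∈ Finset.range K, (f (2 * k) + f (2 * k + 1)) := by
    induction K with
    | zero => simp
    | succ K ih =>
      rw [Finset.sum_range_succ, ← ih, show 2 * (K + 1) = 2 * K + 1 + 1 by ring,
        Finset.sum_range_succ, Finset.sum_range_succ]
      abel
  rw [polyline_eq_sum w hu, polyline_eq_sum w' (K := 2 * (⌊u⌋₊ + 1))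
    (by push_cast at hu ⊢; exact mul_le_mul_right hu 2), hpair, ← Finset.sum_sub_distrib]
  have hterm (k : ℕ) :
      unitClamp (((2 * u : ℝ≥0) : ℝ) - (2 * k : ℕ)) • w' (2 * k) +
        unitClamp (((2 * u : ℝ≥0) : ℝ) - (2 * k + 1 : ℕ)) • w' (2 * k + 1) -
          unitClamp (u - k) • w k =
      (unitClamp (2 * (u - k)) - unitClamp (2 * (u - k) - 1)) • d k := by
    have e1 : ((2 * u : ℝ≥0) : ℝ) - (2 * k : ℕ) = 2 * (u - k) := by push_cast; ring
    have e2 : ((2 * u : ℝ≥0) : ℝ) - (2 * k + 1 : ℕ) = 2 * (u - k) - 1 := by push_cast; ring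
    rw [e1, e2, h0, h1, unitClamp_half (u - k)]
    module
  simp only [hterm]
  refine Finset.sum_eq_single_of_mem _ (Finset.mem_range.2 (Nat.lt_succ_self _)) fun k hk hne ↦ ?_
  have hlt : (k : ℝ) + 1 ≤ ⌊u⌋₊ := by
    have := Finset.mem_range.1 hk
    exact_mod_cast (show k + 1 ≤ ⌊u⌋₊ by omega)
  have hfl : ((⌊u⌋₊ : ℕ) : ℝ) ≤ u := by exact_mod_cast Nat.floor_le (a := u) zero_le
  rw [unitClamp_of_one_le (by linarith), unitClamp_of_one_le (by linarith), sub_self, zero_smul]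

end Polyline

/-! ### Lévy's midpoint construction: convergence and laws -/

section Levy

variable {W : Type*} [NormedAddCommGroup W] [InnerProductSpace ℝ W] [CompleteSpace W]
  [SecondCountableTopology W] [MeasurableSpace W] [BorelSpace W] {μ : Measure W}
  {Ω : Type*} [MeasurableSpace Ω] {P : Measure Ω} {Z : ℕ × ℕ → Ω → W}

/-- The `m`-th polygonal approximation of Brownian motion, with nodes at the multiples of
`2 ^ (-m)`. -/
noncomputable def levyPath (z : ℕ × ℕ → W) (m : ℕ) (t : ℝ≥0) : W :=
  polyline (fun j ↦ Finsupp.linearCombination ℝ z (levyCoeff m j)) (2 ^ m * t)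

theorem continuous_levyPath (z : ℕ × ℕ → W) (m : ℕ) : Continuous (levyPath z m) :=
  (continuous_polyline _).comp (by fun_prop)

theorem levyPath_dyadic (z : ℕ × ℕ → W) (m j : ℕ) :
    levyPath z m (j / 2 ^ m) =
      Finsupp.linearCombination ℝ z (∑ k ∈ Finset.range j, levyCoeff m k) := by
  rw [levyPath, mul_div_cancel₀ _ (by positivity), polyline_natCast, map_sum]

theorem levyPath_succ_sub (z : ℕ × ℕ → W) (m : ℕ) (t : ℝ≥0) :
    levyPath z (m + 1) t - levyPath z m t =
      (unitClamp (2 * ((2 ^ m * t : ℝ≥0) - ⌊2 ^ m * t⌋₊)) -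
        unitClamp (2 * ((2 ^ m * t : ℝ≥0) - ⌊2 ^ m * t⌋₊) - 1)) •
      (√(1 / 2) ^ m / 2) • z (m + 1, ⌊2 ^ m * t⌋₊) := by
  rw [levyPath, levyPath, pow_succ', mul_assoc]
  refine polyline_refine (d := fun k ↦ (√(1 / 2) ^ m / 2) • z (m + 1, k)) (fun k ↦ ?_)
    (fun k ↦ ?_) _
  · simp [levyCoeff]
  · have : (2 * k + 1) / 2 = k := by omega
    simp [levyCoeff, this, pow_succ, ← sub_eq_add_neg, neg_div]

/-- The approximations from the `m`-th on agree at the nodes of the `m`-th. -/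
theorem levyPath_succ_sub_dyadic (z : ℕ × ℕ → W) {m n : ℕ} (h : m ≤ n) (j : ℕ) :
    levyPath z (n + 1) (j / 2 ^ m) - levyPath z n (j / 2 ^ m) = 0 := by
  obtain ⟨i, hi⟩ := dyadicFloor_dyadic h j
  rw [levyPath_succ_sub, hi, mul_div_cancel₀ _ (by positivity)]
  simp [unitClamp]

theorem norm_levyPath_succ_sub_le (z : ℕ × ℕ → W) (m : ℕ) (t : ℝ≥0) :
    ‖levyPath z (m + 1) t - levyPath z m t‖ ≤ √(1 / 2) ^ m * ‖z (m + 1, ⌊2 ^ m * t⌋₊)‖ := by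
  rw [levyPath_succ_sub, norm_smul, norm_smul]
  set v : ℝ := 2 * ((2 ^ m * t : ℝ≥0) - ⌊2 ^ m * t⌋₊)
  have h1 : ‖unitClamp v - unitClamp (v - 1)‖ ≤ 1 := by
    rw [Real.norm_eq_abs, abs_sub_le_iff]
    have := unitClamp_nonneg v
    have := unitClamp_nonneg (v - 1)
    have := unitClamp_le_one v
    have := unitClamp_le_one (v - 1)
    constructor <;> linarith
  have h2 : ‖√(1 / 2 : ℝ) ^ m / 2‖ ≤ √(1 / 2) ^ m := by
    rw [Real.norm_of_nonneg (by positivity)]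
    exact half_le_self (by positivity)
  calc _ ≤ 1 * (√(1 / 2) ^ m * ‖z (m + 1, ⌊2 ^ m * t⌋₊)‖) := by gcongr
    _ = _ := one_mul _

/-- Almost surely the corrections decay geometrically, locally uniformly in time. The fourth
moment of `μ` suffices: up to time `m` there are `m * 2 ^ m` corrections, each of which exceeds
`(9 / 10) ^ m` with probability at most a constant times `(4 * (9 / 10) ^ 4) ^ (-m)`, and
`4 * (9 / 10) ^ 4 > 2`. -/
theorem ae_levy_correction_le [IsProbabilityMeasure P] [IsGaussian μ]
    (hZ : ∀ p, HasLaw (Z p) μ P) :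
    ∀ᵐ ω ∂P, ∀ᶠ m in atTop, ∀ k < m * 2 ^ m,
      √(1 / 2) ^ m * ‖Z (m + 1, k) ω‖ ≤ (9 / 10) ^ m := by
  set E : ℝ := ∫ w, ‖w‖ ^ 4 ∂μ with hE
  have hint : Integrable (fun w : W ↦ ‖w‖ ^ 4) μ :=
    (IsGaussian.memLp_id μ 4 (by simp)).integrable_norm_pow (p := 4) (by norm_num)
  let ρ : ℝ := 2 / (4 * (9 / 10) ^ 4)
  have hr (m : ℕ) : (√(1 / 2 : ℝ) ^ m) ^ 4 = (1 / 4) ^ m := by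
    rw [← pow_mul, mul_comm, pow_mul, show (4 : ℕ) = 2 * 2 from rfl, pow_mul,
      Real.sq_sqrt (by norm_num)]
    norm_num
  have hone (m k : ℕ) : P {ω | (9 / 10) ^ m < √(1 / 2) ^ m * ‖Z (m + 1, k) ω‖} ≤
      ENNReal.ofReal (E * (1 / (4 * (9 / 10) ^ 4)) ^ m) := by
    have h1 := mul_meas_ge_le_integral_of_nonneg (μ := μ) (f := fun w : W ↦ ‖w‖ ^ 4)
      (.of_forall fun w ↦ by positivity) hint ((4 * (9 / 10) ^ 4) ^ m)
    have h2 : μ.real {w | (4 * (9 / 10 : ℝ) ^ 4) ^ m ≤ ‖w‖ ^ 4} ≤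
        E * (1 / (4 * (9 / 10) ^ 4)) ^ m := by
      rw [one_div, inv_pow, ← div_eq_mul_inv, le_div_iff₀ (by positivity), mul_comm]
      exact h1
    have hm : MeasurableSet {w : W | (4 * (9 / 10 : ℝ) ^ 4) ^ m ≤ ‖w‖ ^ 4} :=
      measurableSet_le measurable_const (by fun_prop)
    have h3 : P ((Z (m + 1, k)) ⁻¹' {w | (4 * (9 / 10 : ℝ) ^ 4) ^ m ≤ ‖w‖ ^ 4}) =
        μ {w | (4 * (9 / 10 : ℝ) ^ 4) ^ m ≤ ‖w‖ ^ 4} := by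
      rw [← Measure.map_apply_of_aemeasurable (hZ _).aemeasurable hm, (hZ _).map_eq]
    refine (measure_mono fun ω hω ↦ ?_).trans (h3.le.trans ?_)
    · have h4 : ((9 / 10 : ℝ) ^ m) ^ 4 ≤ (√(1 / 2) ^ m * ‖Z (m + 1, k) ω‖) ^ 4 :=
        pow_le_pow_left₀ (by positivity) (le_of_lt hω) 4
      rw [mul_pow, hr, one_div, inv_pow, ← div_eq_inv_mul, le_div_iff₀ (by positivity)] at h4
      refine le_trans (le_of_eq ?_) h4
      rw [mul_pow, ← pow_mul, ← pow_mul, mul_comm 4 m, mul_comm]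
    · rw [← ENNReal.ofReal_toReal (measure_ne_top μ _)]
      exact ENNReal.ofReal_le_ofReal h2
  have hall (m : ℕ) : P {ω | ¬ ∀ k < m * 2 ^ m,
      √(1 / 2) ^ m * ‖Z (m + 1, k) ω‖ ≤ (9 / 10) ^ m} ≤ ENNReal.ofReal (E * (m ^ 1 * ρ ^ m)) := by
    have hsub : {ω | ¬ ∀ k < m * 2 ^ m, √(1 / 2) ^ m * ‖Z (m + 1, k) ω‖ ≤ (9 / 10) ^ m} ⊆
        ⋃ k ∈ Finset.range (m * 2 ^ m),
          {ω | (9 / 10) ^ m < √(1 / 2) ^ m * ‖Z (m + 1, k) ω‖} := by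
      intro ω hω
      have hω' : ¬ ∀ k < m * 2 ^ m, √(1 / 2) ^ m * ‖Z (m + 1, k) ω‖ ≤ (9 / 10) ^ m := hω
      push Not at hω'
      obtain ⟨k, hk, h⟩ := hω'
      exact Set.mem_biUnion (Finset.mem_coe.2 (Finset.mem_range.2 hk)) h
    refine (measure_mono hsub).trans ((measure_biUnion_finset_le _ _).trans
      ((Finset.sum_le_sum fun k _ ↦ hone m k).trans_eq ?_))
    rw [Finset.sum_const, Finset.card_range, nsmul_eq_mul, ← ENNReal.ofReal_natCast,
      ← ENNReal.ofReal_mul (by positivity)]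
    congr 1
    simp only [ρ, div_pow, one_pow]
    push_cast
    ring
  have hsum : ∑' m : ℕ, P {ω | ¬ ∀ k < m * 2 ^ m,
      √(1 / 2) ^ m * ‖Z (m + 1, k) ω‖ ≤ (9 / 10) ^ m} ≠ ⊤ :=
    ne_top_of_le_ne_top ((summable_pow_mul_geometric_of_norm_lt_one 1 (r := ρ)
      (by norm_num [ρ])).mul_left E).tsum_ofReal_ne_top (ENNReal.tsum_le_tsum hall)
  filter_upwards [ae_eventually_notMem hsum] with ω hω
  filter_upwards [hω] with m hm
  exact not_not.1 hm

/-- Increments of the `m`-th approximation over intervals between nodes have the law of Brownian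
increments. -/
theorem map_levyPath_increments [IsProbabilityMeasure P]
    (hμ : IsCenteredNondegenerateGaussian μ) (hZ : ∀ p, HasLaw (Z p) μ P) (hi : iIndepFun Z P)
    (m : ℕ) {n : ℕ} {t : Fin (n + 1) → ℝ≥0} (ht : Monotone t) :
    P.map (fun ω (i : Fin n) ↦ levyPath (Z · ω) m (dyadicFloor m (t i.succ)) -
        levyPath (Z · ω) m (dyadicFloor m (t i.castSucc))) =
      (Measure.pi fun _ ↦ μ).map fun w i ↦
        √((dyadicFloor m (t i.succ) : ℝ) - dyadicFloor m (t i.castSucc)) • w i := by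
  set k : Fin (n + 1) → ℕ := fun i ↦ ⌊2 ^ m * t i⌋₊ with hk
  have hmono : Monotone k := fun i j hij ↦ Nat.floor_le_floor (mul_le_mul_right (ht hij) _)
  have hle (i : Fin n) : k i.castSucc ≤ k i.succ := hmono (Fin.castSucc_le_succ i)
  have hincr : (fun ω (i : Fin n) ↦ levyPath (Z · ω) m (dyadicFloor m (t i.succ)) -
        levyPath (Z · ω) m (dyadicFloor m (t i.castSucc))) =
      fun ω i ↦ Finsupp.linearCombination ℝ (Z · ω)
        (∑ j ∈ Finset.Ico (k i.castSucc) (k i.succ), levyCoeff m j) := by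
    funext ω i
    rw [dyadicFloor, dyadicFloor, levyPath_dyadic, levyPath_dyadic, ← map_sub,
      Finset.sum_Ico_eq_sub _ (hle i)]
  rw [hincr]
  have hdiff (i : Fin n) : (dyadicFloor m (t i.succ) : ℝ) - dyadicFloor m (t i.castSucc) =
      (Finset.Ico (k i.castSucc) (k i.succ)).card * (1 / 2) ^ m := by
    rw [Nat.card_Ico, Nat.cast_sub (hle i)]
    simp only [dyadicFloor, hk, NNReal.coe_div, NNReal.coe_natCast, NNReal.coe_pow,
      NNReal.coe_ofNat, one_div, inv_pow]
    ring
  refine map_linearCombination_pi hμ hZ hi _ (fun i ↦ ?_) (fun i ↦ ?_) fun i j hij ↦ ?_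
  · rw [hdiff]
    positivity
  · rw [finsuppInner_sum_levyCoeff, Finset.inter_self, hdiff]
  · rw [finsuppInner_sum_levyCoeff, Finset.disjoint_iff_inter_eq_empty.1, Finset.card_empty,
      Nat.cast_zero, zero_mul]
    rcases lt_or_gt_of_ne hij with h | h
    · have := hmono (show i.succ ≤ j.castSucc from h)
      exact Finset.disjoint_left.2 fun a ha hb ↦ by
        simp only [Finset.mem_Ico] at ha hb
        omega
    · have := hmono (show j.succ ≤ i.castSucc from h)
      exact Finset.disjoint_left.2 fun a ha hb ↦ by
        simp only [Finset.mem_Ico] at ha hb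
        omega

/-- A continuous process whose increments have the expected joint law is a Brownian motion. -/
theorem IsBanachBrownianMotion.of_map_increments [IsProbabilityMeasure P] [IsProbabilityMeasure μ]
    {B : ℝ≥0 → Ω → W} {x : W} (hm : ∀ t, Measurable (B t)) (h0 : ∀ᵐ ω ∂P, B 0 ω = x)
    (hc : ∀ᵐ ω ∂P, Continuous fun t ↦ B t ω)
    (h : ∀ (n : ℕ) (t : Fin (n + 1) → ℝ≥0), Monotone t →
      P.map (fun ω (i : Fin n) ↦ B (t i.succ) ω - B (t i.castSucc) ω) =
        (Measure.pi fun _ ↦ μ).map fun w i ↦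
          √((t i.succ : ℝ) - t i.castSucc) • w i) :
    IsBanachBrownianMotion μ x B P := by
  have hprob (r : ℝ) : IsProbabilityMeasure (μ.map fun w ↦ √r • w) :=
    Measure.isProbabilityMeasure_map (by fun_prop)
  have h' (n : ℕ) (t : Fin (n + 1) → ℝ≥0) (ht : Monotone t) :
      P.map (fun ω (i : Fin n) ↦ B (t i.succ) ω - B (t i.castSucc) ω) =
        Measure.pi fun i : Fin n ↦ μ.map fun w ↦ √((t i.succ : ℝ) - t i.castSucc) • w := by
    rw [h n t ht, Measure.pi_map_pi
      (f := fun (i : Fin n) w ↦ √((t i.succ : ℝ) - t i.castSucc) • w) fun i ↦ by fun_prop]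
  have hmarg (n : ℕ) (t : Fin (n + 1) → ℝ≥0) (ht : Monotone t) (i : Fin n) :
      P.map (fun ω ↦ B (t i.succ) ω - B (t i.castSucc) ω) =
        μ.map fun w ↦ √((t i.succ : ℝ) - t i.castSucc) • w := by
    have := congrArg (Measure.map (Function.eval i)) (h' n t ht)
    rwa [Measure.map_map (by fun_prop) (by fun_prop), (measurePreserving_eval _ i).map_eq] at this
  refine ⟨hm, h0, fun n t ht ↦ ?_, fun s t hst ↦ ⟨by fun_prop, ?_⟩, hc⟩
  · rw [iIndepFun_iff_map_fun_eq_pi_map fun i ↦ by fun_prop, h' n t ht]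
    simp_rw [hmarg n t ht]
  · have hmono : Monotone ![s, t] := by
      intro i j hij
      fin_cases i <;> fin_cases j <;> simp_all
    simpa using hmarg 1 ![s, t] hmono 0

/-- The limit of Lévy's polygons is a Brownian motion. -/
theorem exists_isBanachBrownianMotion_of_iid [IsProbabilityMeasure P]
    (hμ : IsCenteredNondegenerateGaussian μ) (mZ : ∀ p, Measurable (Z p))
    (hZ : ∀ p, HasLaw (Z p) μ P) (hi : iIndepFun Z P) (x : W) :
    ∃ B : ℝ≥0 → Ω → W, IsBanachBrownianMotion μ x B P := by
  classical
  have := hμ.gaussian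
  have hb : Summable fun n : ℕ ↦ (9 / 10 : ℝ) ^ n :=
    summable_geometric_of_lt_one (by norm_num) (by norm_num)
  -- A measurable null set outside of which the polygons converge locally uniformly; on it the
  -- process is set constant.
  obtain ⟨N, hN, mN, hN0⟩ := exists_measurable_superset_of_null (ae_levy_correction_le hZ)
  have good {ω : Ω} (hω : ω ∉ N) (t₀ : ℝ≥0) : ∃ n₀, ∀ t ≤ t₀, ∀ m ≥ n₀,
      ‖levyPath (Z · ω) (m + 1) t - levyPath (Z · ω) m t‖ ≤ (9 / 10) ^ m := by
    have h1 : ∀ᶠ m in atTop, ∀ k < m * 2 ^ m,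
        √(1 / 2) ^ m * ‖Z (m + 1, k) ω‖ ≤ (9 / 10) ^ m := not_not.1 fun h ↦ hω (hN h)
    obtain ⟨K, hK⟩ := exists_nat_gt t₀
    obtain ⟨n₀, hn₀⟩ := eventually_atTop.1 h1
    refine ⟨max n₀ K, fun t ht m hm ↦ (norm_levyPath_succ_sub_le _ m t).trans
      (hn₀ m (le_of_max_le_left hm) _ ?_)⟩
    rw [Nat.floor_lt zero_le, mul_comm]
    have hKm : (K : ℝ≥0) ≤ m := by exact_mod_cast le_of_max_le_right hm
    push_cast
    exact mul_lt_mul_of_pos_right (ht.trans_lt (hK.trans_le hKm)) (by positivity)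
  let A (t : ℝ≥0) (ω : Ω) : W := levyPath (Z · ω) 0 t +
    ∑' m, (levyPath (Z · ω) (m + 1) t - levyPath (Z · ω) m t)
  let B (t : ℝ≥0) (ω : Ω) : W := if ω ∈ N then x else x + A t ω
  have hsumm {ω : Ω} (hω : ω ∉ N) (t : ℝ≥0) :
      Summable fun m ↦ levyPath (Z · ω) (m + 1) t - levyPath (Z · ω) m t := by
    obtain ⟨n₀, hn₀⟩ := good hω t
    exact Summable.of_norm_bounded_eventually_nat hb
      (eventually_atTop.2 ⟨n₀, fun m hm ↦ hn₀ t le_rfl m hm⟩)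
  have hconv {ω : Ω} (hω : ω ∉ N) (t : ℝ≥0) :
      Tendsto (fun m ↦ levyPath (Z · ω) m t) atTop (𝓝 (A t ω)) := by
    refine ((hsumm hω t).hasSum.tendsto_sum_nat.const_add (levyPath (Z · ω) 0 t)).congr fun m ↦ ?_
    rw [Finset.sum_range_sub (fun m ↦ levyPath (Z · ω) m t)]
    abel
  have hdyadic (m j : ℕ) (ω : Ω) : A (j / 2 ^ m) ω = levyPath (Z · ω) m (j / 2 ^ m) := by
    simp only [A]
    rw [tsum_eq_sum (s := Finset.range m) fun n hn ↦
      levyPath_succ_sub_dyadic _ (by simpa using hn) j,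
      Finset.sum_range_sub (fun n ↦ levyPath (Z · ω) n (j / 2 ^ m))]
    abel
  have mpath (m : ℕ) (t : ℝ≥0) : Measurable fun ω ↦ levyPath (Z · ω) m t := by
    simp only [levyPath, polyline, Finsupp.linearCombination_apply, Finsupp.sum]
    fun_prop
  have hNae : ∀ᵐ ω ∂P, ω ∉ N := measure_eq_zero_iff_ae_notMem.1 hN0
  have hcont {ω : Ω} (hω : ω ∉ N) : Continuous fun t ↦ A t ω := by
    refine (continuous_levyPath _ 0).add (continuous_iff_continuousAt.2 fun t ↦ ?_)
    obtain ⟨n₀, hn₀⟩ := good hω (t + 1)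
    refine tendsto_tsum_of_eventually_le hb (n₀ := n₀)
      (fun m ↦ ((continuous_levyPath _ (m + 1)).sub (continuous_levyPath _ m)).continuousAt) ?_
    filter_upwards [eventually_lt_nhds (lt_add_one t)] with s hs using hn₀ s hs.le
  refine ⟨B, .of_map_increments (fun t ↦ ?_) ?_ ?_ fun n t ht ↦ ?_⟩
  · refine measurable_of_tendsto_metrizable
      (f := fun m ω ↦ if ω ∈ N then x else x + levyPath (Z · ω) m t)
      (fun m ↦ Measurable.ite mN measurable_const ((mpath m t).const_add x))
      (tendsto_pi_nhds.2 fun ω ↦ ?_)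
    by_cases hω : ω ∈ N
    · simp [hω, B]
    · simpa [hω, B] using (hconv hω t).const_add x
  · refine .of_forall fun ω ↦ ?_
    have h0 : A 0 ω = 0 := by
      have := hdyadic 0 0 ω
      have h' := levyPath_dyadic (Z · ω) 0 0
      simp only [Nat.cast_zero, zero_div, Finset.range_zero, Finset.sum_empty, map_zero] at this h'
      rw [this, h']
    simp [B, h0]
  · filter_upwards [hNae] with ω hω
    simp only [B, if_neg hω]
    exact (hcont hω).const_add x
  · refine map_eq_of_tendsto_ae
      (U := fun m ω (i : Fin n) ↦ levyPath (Z · ω) m (dyadicFloor m (t i.succ)) -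
        levyPath (Z · ω) m (dyadicFloor m (t i.castSucc)))
      (V := fun m w (i : Fin n) ↦
        √((dyadicFloor m (t i.succ) : ℝ) - dyadicFloor m (t i.castSucc)) • w i)
      (fun m ↦ Measurable.aemeasurable (by fun_prop))
      (fun m ↦ Measurable.aemeasurable (by fun_prop)) ?_ (.of_forall fun w ↦ ?_)
      (.of_forall fun m ↦ map_levyPath_increments hμ hZ hi m ht)
    · filter_upwards [hNae] with ω hω
      refine tendsto_pi_nhds.2 fun i ↦ ?_
      have hlim (s : ℝ≥0) : Tendsto (fun m ↦ levyPath (Z · ω) m (dyadicFloor m s)) atTop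
          (𝓝 (A s ω)) :=
        (((hcont hω).tendsto s).comp (tendsto_dyadicFloor s)).congr fun m ↦
          hdyadic m ⌊2 ^ m * s⌋₊ ω
      simpa [B, hω] using (hlim (t i.succ)).sub (hlim (t i.castSucc))
    · refine tendsto_pi_nhds.2 fun i ↦ ?_
      have hlim (s : ℝ≥0) : Tendsto (fun m ↦ (dyadicFloor m s : ℝ)) atTop (𝓝 s) :=
        NNReal.tendsto_coe.2 (tendsto_dyadicFloor s)
      exact ((Real.continuous_sqrt.tendsto _).comp
        ((hlim (t i.succ)).sub (hlim (t i.castSucc)))).smul_const (w i)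

end Levy

universe w

/-- Every centered non-degenerate Gaussian measure has a Brownian motion. -/
theorem exists_isBanachBrownianMotion {W : Type w} [NormedAddCommGroup W] [InnerProductSpace ℝ W]
    [CompleteSpace W] [SecondCountableTopology W] [MeasurableSpace W] [BorelSpace W]
    {μ : Measure W} (hμ : IsCenteredNondegenerateGaussian μ) (x : W) :
    ∃ (Ω : Type w) (_ : MeasurableSpace Ω) (P : Measure Ω) (B : ℝ≥0 → Ω → W),
      IsProbabilityMeasure P ∧ IsBanachBrownianMotion μ x B P := by
  have := hμ.gaussian
  obtain ⟨Ω, mΩ, P, Z, mZ, hZ, hi, hP⟩ := exists_iid (ℕ × ℕ) μ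
  obtain ⟨B, hB⟩ := exists_isBanachBrownianMotion_of_iid hμ mZ hZ hi x
  exact ⟨Ω, mΩ, P, B, hP, hB⟩

/-! ### Coupling at infinity -/

/-- Let `μ` be any centered non-degenerate Gaussian measure on a real separable Hilbert space `W`,
and let `x y : W`. There is a coupling at time `∞` of the `μ`-Brownian motions started at `x` and
`y`; moreover every given `μ`-Brownian motion started at `x` can be so coupled with
a `μ`-Brownian motion started at `y` on the same probability space. -/
theorem corollary4p3 {W : Type u} [NormedAddCommGroup W] [InnerProductSpace ℝ W]
    [CompleteSpace W] [SecondCountableTopology W] [MeasurableSpace W] [BorelSpace W]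
    (μ : Measure W) (hμ : IsCenteredNondegenerateGaussian μ) (x y : W) :
    (∃ (Ω : Type u) (_ : MeasurableSpace Ω) (P : Measure Ω) (B B' : ℝ≥0 → Ω → W),
      IsProbabilityMeasure P ∧ IsBanachBrownianMotion μ x B P ∧
        IsBanachBrownianMotion μ y B' P ∧ CoupleAtInfinity B B' P) ∧
    (∀ (Ω : Type v) [MeasurableSpace Ω] (P : Measure Ω) [IsProbabilityMeasure P]
      (B : ℝ≥0 → Ω → W), IsBanachBrownianMotion μ x B P →
        ∃ B' : ℝ≥0 → Ω → W, IsBanachBrownianMotion μ y B' P ∧ CoupleAtInfinity B B' P) := by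
  refine ⟨?_, fun Ω _ P _ B hB ↦ hB.exists_coupleAtInfinity hμ y⟩
  obtain ⟨Ω, mΩ, P, B, hP, hB⟩ := exists_isBanachBrownianMotion hμ x
  obtain ⟨B', hB', hc⟩ := hB.exists_coupleAtInfinity hμ y
  exact ⟨Ω, mΩ, P, B, B', hP, hB, hB', hc⟩
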